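/- Let $H=\Gamma_s(L^2(\mathbb R_+))$ be the symmetric Fock space, with exponential vectors $e(f)=\bigoplus_{n\ge 0}(n!)^{-1/2}f^{\otimes n}$, $f\in L^2(\mathbb R_+)$, and let $S_t$, $t\ge 0$, be the right shifts on $L^2(\mathbb R_+)$: $(S_t\eta)(x)=\eta(x-t)$ for $x>t$ and $(S_t\eta)(x)=0$ for $0\le x\le t$. Let $\chi(B)$ denote multiplication by the indicator function of $B\subseteq\mathbb R_+$ on $L^2(\mathbb R_+)$, and put $H^\wedge=\mathbb C\Omega\oplus\big(H\otimes L^2(\mathbb R_+)\big)$, where $\Omega$ is a unit vector and $\otimes$ is the Hilbert space tensor product. 1. For every $t\ge0$ there is a unique bounded operator $T_t$ on $H$ with $T_te(f)=e(S_tf)$ for all $f\in L^2(\mathbb R_+)$. The no-event semigroup on $B(H)$ is $\mathcal T_t(x)=T_txT_t^*$. 2. For every $t\ge 0$ there is a unique unitary $V_t\colon\Gamma_s(L^2(0,t))\otimes H\to H$ with $V_t\big(e(f)\otimes e(g)\big)=e(f+S_tg)$ for all $f\in L^2(0,t)$ (extended by zero) and $g\in L^2(\mathbb R_+)$; it is the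 factorisation $H\cong\Gamma_s(L^2(0,t))\otimes\Gamma_s(L^2(t,\infty))$ with $\Gamma_s(L^2(t,\infty))$ identified with $H$ by the shift. The forgetting semigroup on $B(H)$ is $\breve{\mathcal T}_t(x)=V_t(I\otimes x)V_t^*$. 3. There is a unique unitary $W\colon H\to H^\wedge$ with $$We(f)=\Omega\oplus\int_0^{\infty}e(S_s^*f)\otimes\chi(ds)f,\qquad f\in L^2(\mathbb R_+).$$ For $X\in B(H^\wedge)$ put $X^\vee=W^{-1}XW$, and let $\mathcal T_t^\wedge X=W\,\mathcal T_t(X^\vee)\,W^{-1}$ and $\breve{\mathcal T}_t^\wedge X=W\,\breve{\mathcal T}_t(X^\vee)\,W^{-1}$ be the transported semigroups. Then for all $t\ge0$ and $X\in B(H^\wedge)$ $$\mathcal T_t^\wedge X=\big(1\oplus(I\otimes S_t)\big)\,X\,\big(1\oplus(I\otimes S_t^*)\big),$$ the integral $\int_0^t\breve{\mathcal T}_{t-s}(X^\vee)\otimes\chi(ds)$ exists as a bounded operator on $H\otimes L^2(\mathbb R_+)$, and $$\breve{\mathcal T}_t^\wedge X=\mathcal T_t^\wedge X+0\oplus\Big(\int_0^t\breve{\mathcal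 T}_{t-s}(X^\vee)\otimes\chi(ds)\Big).$$ The integrals with respect to $\chi$ are understood weakly: $v=\int_0^\infty F(s)\otimes\chi(ds)f$ means $\langle h\otimes\eta,v\rangle=\int_0^\infty\langle h,F(s)\rangle\,\overline{\eta(s)}f(s)\,ds$ for all $h\in H$, $\eta\in L^2(\mathbb R_+)$, and $R=\int_0^tY(s)\otimes\chi(ds)$ means $\langle h\otimes\eta,R(k\otimes\zeta)\rangle=\int_0^t\langle h,Y(s)k\rangle\,\overline{\eta(s)}\zeta(s)\,ds$ for all $h,k\in H$, $\eta,\zeta\in L^2(\mathbb R_+)$, the integrands being integrable. -/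

import Mathlib

open MeasureTheory Set
open scoped ENNReal NNReal TensorProduct InnerProductSpace ComplexConjugate

namespace FockShift

noncomputable section

/-! ### Hilbert tensor products, direct sums and transport of operators -/

section Hilbert

variable (E F : Type*) [NormedAddCommGroup E] [InnerProductSpace ℂ E]
  [NormedAddCommGroup F] [InnerProductSpace ℂ F]

/-- The Hilbert space tensor product: the completion of the algebraic tensor product in the norm of
the inner product `⟪a ⊗ b, c ⊗ d⟫ = ⟪a, c⟫ * ⟪b, d⟫`. -/
abbrev HTensor : Type _ := UniformSpace.Completion (E ⊗[ℂ] F)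

variable {E F}

/-- The elementary tensor `a ⊗ b` in the Hilbert space tensor product. -/
def tmulH (a : E) (b : F) : HTensor E F := ((a ⊗ₜ[ℂ] b : E ⊗[ℂ] F) : HTensor E F)

theorem exists_orthonormal_sum (z : E ⊗[ℂ] F) :
    ∃ (n : ℕ) (e : Fin n → E) (f : Fin n → F), Orthonormal ℂ e ∧ z = ∑ i, e i ⊗ₜ[ℂ] f i := by
  obtain ⟨E', hE', hz⟩ :=
    TensorProduct.exists_finite_submodule_left_of_setFinite {z} (Set.finite_singleton z)
  obtain ⟨y, rfl⟩ := Set.singleton_subset_iff.mp hz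
  let b := stdOrthonormalBasis ℂ E'
  have key : ∀ y : E' ⊗[ℂ] F, ∃ f : Fin (Module.finrank ℂ E') → F,
      LinearMap.rTensor F E'.subtype y = ∑ i, (b i : E) ⊗ₜ[ℂ] f i := by
    intro y
    induction y using TensorProduct.induction_on with
    | zero => exact ⟨0, by simp⟩
    | tmul x w =>
      refine ⟨fun i => b.repr x i • w, ?_⟩
      have hx : (x : E) = ∑ i, b.repr x i • (b i : E) := by
        conv_lhs => rw [← b.sum_repr x]
        simp
      simp only [LinearMap.rTensor_tmul, Submodule.coe_subtype, TensorProduct.tmul_smul]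
      conv_lhs => rw [hx]
      simp [TensorProduct.sum_tmul, TensorProduct.smul_tmul']
    | add y₁ y₂ h₁ h₂ =>
      obtain ⟨f₁, h₁⟩ := h₁
      obtain ⟨f₂, h₂⟩ := h₂
      exact ⟨f₁ + f₂, by simp [h₁, h₂, TensorProduct.tmul_add, Finset.sum_add_distrib]⟩
  obtain ⟨f, hf⟩ := key y
  exact ⟨_, fun i => (b i : E), f, b.orthonormal.comp_linearIsometry E'.subtypeₗᵢ, hf⟩

theorem norm_sq_orthonormal_sum {n : ℕ} {e : Fin n → E} (he : Orthonormal ℂ e) (f : Fin n → F) :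
    ‖∑ i, e i ⊗ₜ[ℂ] f i‖ ^ 2 = ∑ i, ‖f i‖ ^ 2 := by
  have h : (⟪∑ i, e i ⊗ₜ[ℂ] f i, ∑ i, e i ⊗ₜ[ℂ] f i⟫_ℂ : ℂ) = ∑ i, ⟪f i, f i⟫_ℂ := by
    simp only [sum_inner, inner_sum, TensorProduct.inner_tmul, orthonormal_iff_ite.mp he]
    simp
  have h' := congrArg Complex.re h
  rw [← inner_self_eq_norm_sq (𝕜 := ℂ)]
  simp only [← inner_self_eq_norm_sq (𝕜 := ℂ)]
  exact h'.trans (Complex.re_sum _ _)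

theorem norm_lTensor_le (B : F →L[ℂ] F) (z : E ⊗[ℂ] F) :
    ‖LinearMap.lTensor E (B : F →ₗ[ℂ] F) z‖ ≤ ‖B‖ * ‖z‖ := by
  obtain ⟨n, e, f, he, rfl⟩ := exists_orthonormal_sum z
  refine le_of_sq_le_sq ?_ (by positivity)
  rw [mul_pow, norm_sq_orthonormal_sum he, map_sum]
  simp only [LinearMap.lTensor_tmul, ContinuousLinearMap.coe_coe]
  rw [norm_sq_orthonormal_sum he, Finset.mul_sum]
  refine Finset.sum_le_sum fun i _ => ?_
  rw [← mul_pow]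
  exact pow_le_pow_left₀ (norm_nonneg _) (B.le_opNorm _) 2

variable (E) in
/-- The bounded operator `I ⊗ B` on the Hilbert space tensor product. -/
def idTensor (B : F →L[ℂ] F) : HTensor E F →L[ℂ] HTensor E F :=
  ((LinearMap.lTensor E (B : F →ₗ[ℂ] F)).mkContinuous ‖B‖ (norm_lTensor_le B)).completion

theorem idTensor_tmulH (B : F →L[ℂ] F) (a : E) (b : F) :
    idTensor E B (tmulH a b) = tmulH a (B b) := by
  simp [idTensor, tmulH]

/-- The direct sum `A ⊕ B` of bounded operators, on the Hilbert space direct sum. -/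
def opSum (A : E →L[ℂ] E) (B : F →L[ℂ] F) : WithLp 2 (E × F) →L[ℂ] WithLp 2 (E × F) :=
  ((WithLp.prodContinuousLinearEquiv 2 ℂ E F).symm : (E × F) →L[ℂ] WithLp 2 (E × F)) ∘L
    (A.prodMap B) ∘L
      (WithLp.prodContinuousLinearEquiv 2 ℂ E F : WithLp 2 (E × F) →L[ℂ] E × F)

/-- Transport `U A U⁻¹` of a bounded operator `A` along a unitary `U`. -/
def transport (U : E ≃ₗᵢ[ℂ] F) (A : E →L[ℂ] E) : F →L[ℂ] F :=
  (U.toContinuousLinearEquiv : E →L[ℂ] F) ∘L A ∘L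
    (U.symm.toContinuousLinearEquiv : F →L[ℂ] E)

end Hilbert

/-! ### The symmetric Fock space over `L²(μ)` -/

section Fock

variable {α : Type*} [MeasurableSpace α] (μ : Measure α) [SigmaFinite μ]

/-- The `n`-th Hilbert tensor power of `L²(μ)`, realised as `L²(μⁿ)`. -/
abbrev L2Pow (n : ℕ) : Type _ := Lp ℂ 2 (Measure.pi fun _ : Fin n => μ)

theorem measurePreserving_perm {n : ℕ} (σ : Equiv.Perm (Fin n)) :
    MeasurePreserving (fun x : Fin n → α => x ∘ σ)
      (Measure.pi fun _ : Fin n => μ) (Measure.pi fun _ : Fin n => μ) := by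
  have h := measurePreserving_piCongrLeft (α := fun _ : Fin n => α) (fun _ : Fin n => μ) σ.symm
  convert h using 1
  ext x i
  have := Equiv.piCongrLeft_apply_apply (fun _ : Fin n => α) σ.symm x (σ i)
  simpa [MeasurableEquiv.coe_piCongrLeft] using this.symm

/-- The unitary action of a permutation of the `n` coordinates. -/
def permAct {n : ℕ} (σ : Equiv.Perm (Fin n)) : L2Pow μ n →ₗᵢ[ℂ] L2Pow μ n :=
  Lp.compMeasurePreservingₗᵢ ℂ (fun x => x ∘ σ) (measurePreserving_perm μ σ)

/-- The `n`-particle space: the symmetric elements of `L²(μⁿ)`. -/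
def symPow (n : ℕ) : Submodule ℂ (L2Pow μ n) where
  carrier := {ψ | ∀ σ : Equiv.Perm (Fin n), permAct μ σ ψ = ψ}
  add_mem' := fun ha hb σ => by rw [map_add, ha σ, hb σ]
  zero_mem' := fun σ => map_zero _
  smul_mem' := fun c x hx σ => by rw [map_smul, hx σ]

theorem isClosed_symPow (n : ℕ) : IsClosed (symPow μ n : Set (L2Pow μ n)) := by
  have : (symPow μ n : Set (L2Pow μ n)) = ⋂ σ : Equiv.Perm (Fin n), {ψ | permAct μ σ ψ = ψ} := by
    ext ψ
    simp [symPow]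
  rw [this]
  exact isClosed_iInter fun σ => isClosed_eq (permAct μ σ).continuous continuous_id

instance (n : ℕ) : CompleteSpace (symPow μ n) := (isClosed_symPow μ n).completeSpace_coe

/-- The symmetric Fock space `Γ_s(L²(μ))`: the Hilbert direct sum of the `n`-particle spaces. -/
abbrev Fock : Type _ := lp (fun n : ℕ => symPow μ n) 2

variable {μ}

theorem memLp_prod_apply (f : Lp ℂ 2 μ) (n : ℕ) :
    MemLp (fun x : Fin n → α => ∏ i, f (x i)) 2 (Measure.pi fun _ : Fin n => μ) := by
  have hm : AEStronglyMeasurable (fun x : Fin n → α => ∏ i, f (x i))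
      (Measure.pi fun _ : Fin n => μ) := by
    refine Finset.aestronglyMeasurable_fun_prod _ fun i _ => ?_
    exact ((Lp.stronglyMeasurable f).comp_measurable (measurable_pi_apply i)).aestronglyMeasurable
  rw [memLp_two_iff_integrable_sq_norm hm]
  have hf : Integrable (fun x => ‖f x‖ ^ 2) μ :=
    (memLp_two_iff_integrable_sq_norm (Lp.aestronglyMeasurable f)).mp (Lp.memLp f)
  have := Integrable.fintype_prod (ι := Fin n) (μ := fun _ => μ) (f := fun _ x => ‖f x‖ ^ 2)
    (fun _ => hf)
  simpa [norm_prod, Finset.prod_pow] using this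

/-- The tensor power `f ⊗ ⋯ ⊗ f`, that is the function `(x₁, …, xₙ) ↦ f x₁ ⋯ f xₙ`. -/
def tpow (f : Lp ℂ 2 μ) (n : ℕ) : symPow μ n :=
  ⟨(memLp_prod_apply f n).toLp, fun σ => by
    change Lp.compMeasurePreserving _ (measurePreserving_perm μ σ) _ = _
    rw [Lp.toLp_compMeasurePreserving, MemLp.toLp_eq_toLp_iff]
    refine Filter.Eventually.of_forall fun x => ?_
    exact Equiv.prod_comp σ fun i => f (x i)⟩

theorem norm_sq_eq_integral {β : Type*} [MeasurableSpace β] {ν : Measure β} (g : Lp ℂ 2 ν) :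
    ‖g‖ ^ 2 = ∫ x, ‖g x‖ ^ 2 ∂ν := by
  have h : ⟪g, g⟫_ℂ = ∫ x, ((‖g x‖ ^ 2 : ℝ) : ℂ) ∂ν := by
    rw [L2.inner_def]
    refine integral_congr_ae (Filter.Eventually.of_forall fun x => ?_)
    simp [inner_self_eq_norm_sq_to_K]
  rw [integral_complex_ofReal, inner_self_eq_norm_sq_to_K] at h
  exact Complex.ofReal_injective (by simpa using h)

theorem norm_tpow (f : Lp ℂ 2 μ) (n : ℕ) : ‖tpow f n‖ = ‖f‖ ^ n := by
  have h : ‖tpow f n‖ ^ 2 = (‖f‖ ^ n) ^ 2 := by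
    have h1 : ‖tpow f n‖ = ‖(memLp_prod_apply f n).toLp‖ := rfl
    rw [h1, norm_sq_eq_integral, pow_right_comm, norm_sq_eq_integral f]
    have h2 : ∫ x, ‖((memLp_prod_apply f n).toLp : L2Pow μ n) x‖ ^ 2 ∂(Measure.pi fun _ : Fin n => μ) =
        ∫ x, ‖∏ i, f (x i)‖ ^ 2 ∂(Measure.pi fun _ : Fin n => μ) :=
      integral_congr_ae ((memLp_prod_apply f n).coeFn_toLp.fun_comp fun z => ‖z‖ ^ 2)
    rw [h2]
    simp only [norm_prod, ← Finset.prod_pow]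
    have := integral_fintype_prod_eq_pow (ι := Fin n) (μ := μ) (fun x => ‖f x‖ ^ 2)
    simpa using this
  exact (pow_left_inj₀ (norm_nonneg _) (by positivity) two_ne_zero).mp h

/-- The exponential vector `e(f) = ⊕ₙ (n!)^(-1/2) f^{⊗n}`. -/
def expVec (f : Lp ℂ 2 μ) : Fock μ :=
  ⟨fun n => ((Real.sqrt n.factorial : ℂ))⁻¹ • tpow f n, by
    refine memℓp_gen ?_
    have h : Summable fun n : ℕ => (‖f‖ ^ 2) ^ n / n.factorial :=
      Real.summable_pow_div_factorial _
    refine h.congr fun n => ?_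
    rw [norm_smul, norm_tpow]
    simp [mul_pow, ← pow_mul, mul_comm, div_eq_mul_inv]⟩

end Fock

/-! ### The half-line -/

/-- `L²(ℝ₊)`. -/
abbrev L2R : Type := Lp ℂ 2 (volume.restrict (Ici (0 : ℝ)))

/-- `H = Γ_s(L²(ℝ₊))`. -/
abbrev FockR : Type := Fock (volume.restrict (Ici (0 : ℝ)))

/-- `L²(0, t)`. -/
abbrev L2I (t : ℝ≥0) : Type := Lp ℂ 2 (volume.restrict (Ioo (0 : ℝ) t))

/-- `Γ_s(L²(0, t))`. -/
abbrev FockI (t : ℝ≥0) : Type := Fock (volume.restrict (Ioo (0 : ℝ) t))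

/-- `H^∧ = ℂΩ ⊕ (H ⊗ L²(ℝ₊))`, the vector `Ω` being `1 ∈ ℂ`. -/
abbrev HWedge : Type := WithLp 2 (ℂ × HTensor FockR L2R)

/-- The pointwise formula of the right shift: `x ↦ η (x - t)` for `x > t`, and `0` otherwise. -/
def shiftFun (t : ℝ≥0) (η : ℝ → ℂ) (x : ℝ) : ℂ := if (t : ℝ) < x then η (x - t) else 0

theorem eLpNorm_shiftFun (t : ℝ≥0) (η : L2R) :
    eLpNorm (shiftFun t η) 2 (volume.restrict (Ici (0 : ℝ))) =
      eLpNorm η 2 (volume.restrict (Ici (0 : ℝ))) := by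
  have hs : shiftFun t η = (Ioi (t : ℝ)).indicator (fun x => η (x - t)) := by
    ext x
    simp [shiftFun, indicator]
  have hmp : MeasurePreserving (fun x : ℝ => x - t) (volume.restrict (Ioi (t : ℝ)))
      (volume.restrict (Ici (0 : ℝ))) := by
    have := (measurePreserving_sub_right (volume : Measure ℝ) (t : ℝ)).restrict_preimage
      (measurableSet_Ioi (a := (0 : ℝ)))
    rw [← restrict_Ioi_eq_restrict_Ici]
    convert this using 2
    simp
  have hi : Ioi (t : ℝ) ∩ Ici 0 = Ioi (t : ℝ) := inter_eq_left.mpr (Ioi_subset_Ici t.2)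
  rw [hs, eLpNorm_indicator_eq_eLpNorm_restrict measurableSet_Ioi,
    Measure.restrict_restrict measurableSet_Ioi, hi]
  exact eLpNorm_comp_measurePreserving (Lp.aestronglyMeasurable η) hmp

theorem memLp_shiftFun (t : ℝ≥0) (η : L2R) :
    MemLp (shiftFun t η) 2 (volume.restrict (Ici (0 : ℝ))) := by
  refine ⟨?_, by rw [eLpNorm_shiftFun]; exact Lp.eLpNorm_lt_top η⟩
  refine (StronglyMeasurable.ite measurableSet_Ioi ?_ stronglyMeasurable_const).aestronglyMeasurable
  exact (Lp.stronglyMeasurable η).comp_measurable (measurable_id.sub_const _)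

theorem shiftFun_congr (t : ℝ≥0) {η ζ : ℝ → ℂ}
    (h : η =ᵐ[volume.restrict (Ici (0 : ℝ))] ζ) :
    shiftFun t η =ᵐ[volume.restrict (Ici (0 : ℝ))] shiftFun t ζ := by
  refine ae_restrict_of_ae ?_
  rw [Filter.EventuallyEq, ae_restrict_iff' measurableSet_Ici] at h
  filter_upwards [(measurePreserving_sub_right (volume : Measure ℝ) (t : ℝ)).quasiMeasurePreserving.ae h]
    with x hx
  unfold shiftFun
  split_ifs with hlt
  · exact hx (sub_nonneg.mpr hlt.le)
  · rfl

/-- The right shift `S_t` on `L²(ℝ₊)`, an isometry. -/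
def shift (t : ℝ≥0) : L2R →ₗᵢ[ℂ] L2R where
  toFun η := (memLp_shiftFun t η).toLp
  map_add' η ζ := by
    rw [← MemLp.toLp_add, MemLp.toLp_eq_toLp_iff]
    refine (shiftFun_congr t (Lp.coeFn_add η ζ)).trans (Filter.Eventually.of_forall fun x => ?_)
    simp only [shiftFun, Pi.add_apply]
    split_ifs <;> simp
  map_smul' c η := by
    rw [RingHom.id_apply, ← MemLp.toLp_const_smul, MemLp.toLp_eq_toLp_iff]
    refine (shiftFun_congr t (Lp.coeFn_smul c η)).trans (Filter.Eventually.of_forall fun x => ?_)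
    simp only [shiftFun, Pi.smul_apply]
    split_ifs <;> simp
  norm_map' η := by
    change ‖(memLp_shiftFun t η).toLp‖ = _
    rw [Lp.norm_toLp, eLpNorm_shiftFun, Lp.norm_def]

/-- `S_t` as a bounded operator. -/
def S (t : ℝ≥0) : L2R →L[ℂ] L2R := (shift t).toContinuousLinearMap

/-- The adjoint `S_t*`. -/
def Sadj (t : ℝ≥0) : L2R →L[ℂ] L2R := ContinuousLinearMap.adjoint (S t)

theorem memLp_indicator_Ioo (t : ℝ≥0) (f : L2I t) :
    MemLp ((Ioo (0 : ℝ) t).indicator f) 2 (volume.restrict (Ici (0 : ℝ))) := by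
  rw [memLp_indicator_iff_restrict measurableSet_Ioo, Measure.restrict_restrict measurableSet_Ioo,
    inter_eq_left.mpr (Ioo_subset_Ioi_self.trans Ioi_subset_Ici_self)]
  exact Lp.memLp f

/-- The inclusion `L²(0, t) ⊆ L²(ℝ₊)`, extension by zero. -/
def extendZero (t : ℝ≥0) (f : L2I t) : L2R := (memLp_indicator_Ioo t f).toLp

/-! ### The two semigroups -/

/-- `T` is the operator `T_t` on `H`: the second quantisation of `S_t`, so `T_t e(f) = e(S_t f)`. -/
def IsShiftOp (t : ℝ≥0) (T : FockR →L[ℂ] FockR) : Prop :=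
  ∀ f : L2R, T (expVec f) = expVec (S t f)

/-- The no-event map `x ↦ T x T*`. -/
def noEvent (T x : FockR →L[ℂ] FockR) : FockR →L[ℂ] FockR :=
  T ∘L x ∘L ContinuousLinearMap.adjoint T

/-- `V` is the natural factorisation `Γ_s(L²(0, t)) ⊗ H ≅ Γ_s(L²(0, t)) ⊗ Γ_s(L²(t, ∞)) ≅ H`.
The first map identifies `H` with `Γ_s(L²(t, ∞))` by shifting, `e(g) ↦ e(S_t g)`; the second one
sends `e(f) ⊗ e(k)` to `e(f + k)`. -/
def IsFactorization (t : ℝ≥0) (V : HTensor (FockI t) FockR ≃ₗᵢ[ℂ] FockR) : Prop :=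
  ∀ (f : L2I t) (g : L2R), V (tmulH (expVec f) (expVec g)) = expVec (extendZero t f + S t g)

/-- The forgetting map `x ↦ I ⊗ x`, where `I` is the identity of `Γ_s(L²(0, t))` and `x` acts on the
copy `Γ_s(L²(t, ∞))` of `H`. -/
def forget {t : ℝ≥0} (V : HTensor (FockI t) FockR ≃ₗᵢ[ℂ] FockR) (x : FockR →L[ℂ] FockR) :
    FockR →L[ℂ] FockR :=
  transport V (idTensor (FockI t) x)

/-! ### Integrals against the projection-valued measure `χ`

`χ(B)` is multiplication by the indicator of `B` on `L²(ℝ₊)`, so that the complex measure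
`⟪η, χ(ds) ζ⟫` is `conj (η s) * ζ s ds`. Integrals are understood in the weak sense, tested on
elementary tensors, which span a dense subspace. -/

/-- `v = ∫₀^∞ F(s) ⊗ χ(ds) f` in `H ⊗ L²(ℝ₊)`. -/
def IsVectorIntegral (F : ℝ≥0 → FockR) (f : L2R) (v : HTensor FockR L2R) : Prop :=
  ∀ (h : FockR) (η : L2R),
    IntegrableOn (fun s : ℝ => ⟪h, F s.toNNReal⟫_ℂ * (conj (η s) * f s)) (Ici 0) ∧
    ⟪tmulH h η, v⟫_ℂ = ∫ s in Ici (0 : ℝ), ⟪h, F s.toNNReal⟫_ℂ * (conj (η s) * f s)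

/-- `R = ∫₀ᵗ Y(s) ⊗ χ(ds)` as a bounded operator on `H ⊗ L²(ℝ₊)`. -/
def IsOperatorIntegral (t : ℝ≥0) (Y : ℝ≥0 → FockR →L[ℂ] FockR)
    (R : HTensor FockR L2R →L[ℂ] HTensor FockR L2R) : Prop :=
  ∀ (h k : FockR) (η ζ : L2R),
    IntegrableOn (fun s : ℝ => ⟪h, Y s.toNNReal k⟫_ℂ * (conj (η s) * ζ s)) (Ico 0 (t : ℝ)) ∧
    ⟪tmulH h η, R (tmulH k ζ)⟫_ℂ =
      ∫ s in Ico 0 (t : ℝ), ⟪h, Y s.toNNReal k⟫_ℂ * (conj (η s) * ζ s)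

/-- `W` is the unitary `H → H^∧` with `W e(f) = Ω ⊕ ∫₀^∞ e(S_s* f) ⊗ χ(ds) f`. -/
def IsWedgeMap (W : FockR ≃ₗᵢ[ℂ] HWedge) : Prop :=
  ∀ f : L2R, (W (expVec f)).fst = 1 ∧
    IsVectorIntegral (fun s => expVec (Sadj s f)) f (W (expVec f)).snd

end

end FockShift

open FockShift

/-!
Everything is computed on exponential vectors. They are total in the Fock space
(`isTotal_expVec`) and satisfy `⟪e(f), e(g)⟫ = exp ⟪f, g⟫` (`inner_expVec`), so an isometry or a
unitary with prescribed values on them exists as soon as Gram matrices agree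
(`IsTotal.exists_isometry`, `IsTotal.exists_unitary`), and operators are equal as soon as their
matrix elements between total families are.

For `T_t` the Gram matrices agree because `S_t` is an isometry. For `V_t` they agree because
`L²(ℝ₊) = L²(0, t) ⊕ S_t L²(ℝ₊)` orthogonally, with `f = f 1_{(0, t)} + S_t S_t* f`.

For `W`, the space `H ⊗ L²(ℝ₊)` is identified with `L²(ℝ₊; H)` (`fieldEquiv`), where
`w(f) = ∫ e(S_s* f) ⊗ χ(ds) f` is the function `s ↦ f(s) e(S_s* f)`. Since
`⟪S_s* f, S_s* g⟫ = ∫_s^∞ conj f g`, the identity `⟪w(f), w(g)⟫ = exp ⟪f, g⟫ - 1` is the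
fundamental theorem of calculus for `s ↦ exp (∫_s^∞ φ)` with `φ = conj f g` (`integral_exp_mul`).
Surjectivity is `isTotal_wedge`: if `ψ ∈ L²(ℝ₊; H)` is orthogonal to all `w(f)`, testing against
`f = S_t g + ε 1_A` with `A ⊆ [0, t)` and letting `ε → 0` gives `⟪e(S_{t-s} g), ψ(s)⟫ = 0` for
almost every `s < t`; letting `t` decrease to `s` through rationals, `⟪e(g), ψ(s)⟫ = 0`.

The formula for the no-event semigroup is the intertwining relation `W T_t = (1 ⊕ (I ⊗ S_t)) W`,
a change of variables in the integral defining `w(S_t f)` (`idTensor_S_wedgeVec`).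
For the forgetting semigroup, put `m = ⟪e(S_t* f), x e(S_t* g)⟫`. The matrix elements of the
no-event and forgetting maps between `e(f)` and `e(g)` are `m` and `exp (∫_0^t φ) m`, and

  `∫_0^t ⟪e(S_s* f), forget_{t-s}(x) e(S_s* g)⟫ φ(s) ds = m ∫_0^t exp (∫_s^t φ) φ(s) ds
    = m (exp (∫_0^t φ) - 1)`,

again by `integral_exp_mul`. The operator integral itself is multiplication, on `L²(ℝ₊; H)`, by the
bounded operator field `s ↦ forget_{t-s}(x)`, which is strongly continuous (`continuous_forget`).
-/

namespace FockShift

noncomputable section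

/-! ### Total families and their Gram matrices -/

section Hilbert

variable {E F ι κ : Type*} [NormedAddCommGroup E] [InnerProductSpace ℂ E]
  [NormedAddCommGroup F] [InnerProductSpace ℂ F]

/-- A family of vectors is total if its linear span is dense. -/
def IsTotal (a : ι → E) : Prop := Dense (Submodule.span ℂ (range a) : Set E)

/-- In a complete space a family with trivial orthogonal complement is total. -/
theorem isTotal_of_forall_inner_eq_zero [CompleteSpace E] {a : ι → E}
    (h : ∀ v : E, (∀ i, ⟪a i, v⟫_ℂ = 0) → v = 0) : IsTotal a := by
  rw [IsTotal, Submodule.dense_iff_topologicalClosure_eq_top,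
    Submodule.topologicalClosure_eq_top_iff, eq_bot_iff]
  intro v hv
  exact h v fun i => hv _ (Submodule.subset_span ⟨i, rfl⟩)

theorem IsTotal.clm_ext {a : ι → E} (ha : IsTotal a) {A B : E →L[ℂ] F}
    (h : ∀ i, A (a i) = B (a i)) : A = B :=
  ContinuousLinearMap.ext_on ha (by rintro _ ⟨i, rfl⟩; exact h i)

theorem IsTotal.eq_of_inner {a : ι → E} (ha : IsTotal a) {v w : E}
    (h : ∀ i, ⟪a i, v⟫_ℂ = ⟪a i, w⟫_ℂ) : v = w := by
  have : innerSL ℂ v = innerSL ℂ w := ha.clm_ext fun i => by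
    simpa using congrArg conj (h i)
  exact ext_inner_right ℂ fun x => by simpa using congrArg (fun L => L x) this

theorem IsTotal.clm_ext_inner {a : ι → E} {b : κ → F} (ha : IsTotal a) (hb : IsTotal b)
    {A B : E →L[ℂ] F} (h : ∀ i j, ⟪b j, A (a i)⟫_ℂ = ⟪b j, B (a i)⟫_ℂ) : A = B :=
  ha.clm_ext fun i => hb.eq_of_inner (h i)

theorem IsTotal.denseRange {a : ι → E} (ha : IsTotal a) :
    DenseRange (Finsupp.linearCombination ℂ a) := by
  rw [IsTotal, ← Finsupp.range_linearCombination] at ha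
  simpa [DenseRange, LinearMap.coe_range] using ha

/-- Families with the same Gram matrix are related by a linear isometry. -/
theorem IsTotal.exists_isometry [CompleteSpace F] {a : ι → E} {b : ι → F} (ha : IsTotal a)
    (h : ∀ i j, ⟪a i, a j⟫_ℂ = ⟪b i, b j⟫_ℂ) :
    ∃ L : E →ₗᵢ[ℂ] F, ∀ i, L (a i) = b i := by
  have hn : ∀ c : ι →₀ ℂ, ‖Finsupp.linearCombination ℂ b c‖ =
      ‖Finsupp.linearCombination ℂ a c‖ := fun c => by
    have : ⟪Finsupp.linearCombination ℂ b c, Finsupp.linearCombination ℂ b c⟫_ℂ =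
        ⟪Finsupp.linearCombination ℂ a c, Finsupp.linearCombination ℂ a c⟫_ℂ := by
      simp only [Finsupp.linearCombination_apply, Finsupp.sum, sum_inner, inner_sum,
        inner_smul_left, inner_smul_right, h]
    rw [← sq_eq_sq₀ (norm_nonneg _) (norm_nonneg _), ← inner_self_eq_norm_sq (𝕜 := ℂ),
      ← inner_self_eq_norm_sq (𝕜 := ℂ), this]
  have hb : ∃ C : ℝ, ∀ c, ‖Finsupp.linearCombination ℂ b c‖ ≤
      C * ‖Finsupp.linearCombination ℂ a c‖ := ⟨1, fun c => by rw [hn, one_mul]⟩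
  let L := (Finsupp.linearCombination ℂ b).extendOfNorm (Finsupp.linearCombination ℂ a)
  have hL : ∀ c, L (Finsupp.linearCombination ℂ a c) = Finsupp.linearCombination ℂ b c :=
    LinearMap.extendOfNorm_eq ha.denseRange hb
  refine ⟨⟨L, fun x => ?_⟩, fun i => ?_⟩
  · refine ha.denseRange.induction_on (p := fun x => ‖L x‖ = ‖x‖) x
      (isClosed_eq (by fun_prop) (by fun_prop)) fun c => ?_
    rw [hL, hn]
  · simpa using hL (Finsupp.single i 1)

theorem IsTotal.exists_unitary [CompleteSpace E] [CompleteSpace F] {a : ι → E} {b : ι → F}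
    (ha : IsTotal a) (hb : IsTotal b) (h : ∀ i j, ⟪a i, a j⟫_ℂ = ⟪b i, b j⟫_ℂ) :
    ∃ U : E ≃ₗᵢ[ℂ] F, ∀ i, U (a i) = b i := by
  obtain ⟨L, hL⟩ := ha.exists_isometry h
  obtain ⟨M, hM⟩ := hb.exists_isometry fun i j => (h i j).symm
  have hLM : L.toContinuousLinearMap ∘L M.toContinuousLinearMap = .id ℂ F :=
    hb.clm_ext fun i => by simp [hL, hM]
  exact ⟨LinearIsometryEquiv.ofSurjective L fun y => ⟨M y, by
    simpa using congrArg (fun A => A y) hLM⟩, hL⟩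

theorem IsTotal.unitary_ext {a : ι → E} (ha : IsTotal a) {U V : E ≃ₗᵢ[ℂ] F}
    (h : ∀ i, U (a i) = V (a i)) : U = V := by
  have : (U.toContinuousLinearEquiv : E →L[ℂ] F) = V.toContinuousLinearEquiv :=
    ha.clm_ext fun i => by simpa using h i
  ext x
  simpa using congrArg (fun A => A x) this

theorem IsTotal.id : IsTotal (fun x : E => x) := by simp [IsTotal]

/-! ### Hilbert tensor products -/

theorem inner_tmulH (a a' : E) (b b' : F) :
    ⟪tmulH a b, tmulH a' b'⟫_ℂ = ⟪a, a'⟫_ℂ * ⟪b, b'⟫_ℂ := by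
  simp [tmulH, UniformSpace.Completion.inner_coe]

/-- The elementary tensor as a continuous bilinear map. -/
def tmulHL : E →L[ℂ] F →L[ℂ] HTensor E F :=
  (ContinuousLinearMap.compL ℂ F (E ⊗[ℂ] F) (HTensor E F) UniformSpace.Completion.toComplL) ∘L
    TensorProduct.mkL ℂ E F

theorem tmulHL_apply (a : E) (b : F) : tmulHL a b = tmulH a b := rfl

theorem isTotal_tmulH {a : ι → E} {b : κ → F} (ha : IsTotal a) (hb : IsTotal b) :
    IsTotal fun p : ι × κ => tmulH (a p.1) (b p.2) := by
  refine isTotal_of_forall_inner_eq_zero fun v hv => ?_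
  have h1 : ∀ j x, ⟪v, tmulH x (b j)⟫_ℂ = 0 := fun j x => by
    have : innerSL ℂ v ∘L tmulHL.flip (b j) = 0 := ha.clm_ext fun i => by
      simpa [tmulHL_apply, inner_eq_zero_symm] using hv (i, j)
    simpa using! congrArg (fun L => L x) this
  have h2 : ∀ x y, ⟪v, tmulH x y⟫_ℂ = 0 := fun x y => by
    have : innerSL ℂ v ∘L tmulHL x = 0 := hb.clm_ext fun j => by
      simpa [tmulHL_apply] using h1 j x
    simpa using! congrArg (fun L => L y) this
  refine ext_inner_right ℂ fun z => ?_
  rw [inner_zero_left]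
  refine UniformSpace.Completion.denseRange_coe.induction_on (p := fun z => ⟪v, z⟫_ℂ = 0) z
    (isClosed_eq (by fun_prop) (by fun_prop)) fun z => ?_
  induction z using TensorProduct.induction_on with
  | zero => exact inner_zero_right v
  | tmul x y => exact h2 x y
  | add x y hx hy => rw [UniformSpace.Completion.coe_add, inner_add_right, hx, hy, add_zero]

/-- All elementary tensors together are total. -/
theorem isTotal_tmulH' : IsTotal fun p : E × F => tmulH p.1 p.2 :=
  isTotal_tmulH (a := fun x : E => x) (b := fun y : F => y) IsTotal.id IsTotal.id

theorem norm_idTensor_le (B : F →L[ℂ] F) : ‖idTensor E B‖ ≤ ‖B‖ := by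
  refine ContinuousLinearMap.opNorm_le_bound _ (norm_nonneg _) fun z => ?_
  refine UniformSpace.Completion.denseRange_coe.induction_on
    (p := fun z => ‖idTensor E B z‖ ≤ ‖B‖ * ‖z‖) z
    (isClosed_le (by fun_prop) (by fun_prop)) fun z => ?_
  simpa [idTensor] using norm_lTensor_le B z

theorem idTensor_comp (A B : F →L[ℂ] F) : idTensor E (A ∘L B) = idTensor E A ∘L idTensor E B :=
  isTotal_tmulH'.clm_ext fun p => by simp [idTensor_tmulH]

theorem adjoint_idTensor [CompleteSpace F] (B : F →L[ℂ] F) :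
    ContinuousLinearMap.adjoint (idTensor E B) = idTensor E (ContinuousLinearMap.adjoint B) :=
  isTotal_tmulH'.clm_ext_inner isTotal_tmulH' fun p q => by
    rw [ContinuousLinearMap.adjoint_inner_right, idTensor_tmulH, idTensor_tmulH, inner_tmulH,
      inner_tmulH, ContinuousLinearMap.adjoint_inner_right]

/-! ### Direct sums and transport -/

@[simp] theorem opSum_fst (A : E →L[ℂ] E) (B : F →L[ℂ] F) (x : WithLp 2 (E × F)) :
    (opSum A B x).fst = A x.fst := rfl

@[simp] theorem opSum_snd (A : E →L[ℂ] E) (B : F →L[ℂ] F) (x : WithLp 2 (E × F)) :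
    (opSum A B x).snd = B x.snd := rfl

theorem adjoint_opSum [CompleteSpace E] [CompleteSpace F] (A : E →L[ℂ] E) (B : F →L[ℂ] F) :
    ContinuousLinearMap.adjoint (opSum A B) =
      opSum (ContinuousLinearMap.adjoint A) (ContinuousLinearMap.adjoint B) := by
  symm
  rw [ContinuousLinearMap.eq_adjoint_iff]
  intro x y
  simp [WithLp.prod_inner_apply, ContinuousLinearMap.adjoint_inner_left]

@[simp] theorem transport_apply (U : E ≃ₗᵢ[ℂ] F) (A : E →L[ℂ] E) (y : F) :
    transport U A y = U (A (U.symm y)) := rfl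

theorem norm_transport_le (U : E ≃ₗᵢ[ℂ] F) (A : E →L[ℂ] E) : ‖transport U A‖ ≤ ‖A‖ :=
  ContinuousLinearMap.opNorm_le_bound _ (norm_nonneg _) fun y => by
    simpa using A.le_opNorm (U.symm y)

theorem transport_comp (U : E ≃ₗᵢ[ℂ] F) (A B : E →L[ℂ] E) :
    transport U (A ∘L B) = transport U A ∘L transport U B := by
  ext y; simp

theorem adjoint_transport [CompleteSpace E] [CompleteSpace F] (U : E ≃ₗᵢ[ℂ] F) (A : E →L[ℂ] E) :
    ContinuousLinearMap.adjoint (transport U A) = transport U (ContinuousLinearMap.adjoint A) := by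
  symm
  rw [ContinuousLinearMap.eq_adjoint_iff]
  intro x y
  have h1 : ∀ (z : E) (w : F), ⟪U z, w⟫_ℂ = ⟪z, U.symm w⟫_ℂ := fun z w => by
    rw [← U.inner_map_map z, U.apply_symm_apply]
  have h2 : ∀ (z : E) (w : F), ⟪w, U z⟫_ℂ = ⟪U.symm w, z⟫_ℂ := fun z w => by
    rw [← U.inner_map_map _ z, U.apply_symm_apply]
  simp [h1, h2, ContinuousLinearMap.adjoint_inner_left]

end Hilbert

/-! ### The Gram matrix of the exponential vectors -/

section Fock

variable {α : Type*} [MeasurableSpace α] {μ : Measure α} [SigmaFinite μ]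

theorem inner_eq_integral {β : Type*} [MeasurableSpace β] {ν : Measure β} (f g : Lp ℂ 2 ν) :
    ⟪f, g⟫_ℂ = ∫ x, conj (f x) * g x ∂ν := by
  simp [L2.inner_def, RCLike.inner_apply, mul_comm]

theorem integrable_conj_mul {β : Type*} [MeasurableSpace β] {ν : Measure β} (f g : Lp ℂ 2 ν) :
    Integrable (fun x => conj (f x) * g x) ν := by
  simpa [RCLike.inner_apply, mul_comm] using L2.integrable_inner (𝕜 := ℂ) f g

theorem tpow_coeFn (f : Lp ℂ 2 μ) (n : ℕ) :
    ((tpow f n : L2Pow μ n) : (Fin n → α) → ℂ) =ᵐ[Measure.pi fun _ => μ] fun x => ∏ i, f (x i) :=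
  (memLp_prod_apply f n).coeFn_toLp

theorem inner_tpow (f g : Lp ℂ 2 μ) (n : ℕ) : ⟪tpow f n, tpow g n⟫_ℂ = ⟪f, g⟫_ℂ ^ n := by
  rw [Submodule.coe_inner, inner_eq_integral, inner_eq_integral]
  have := integral_fintype_prod_eq_pow (ι := Fin n) (μ := μ) (fun x => conj (f x) * g x)
  rw [Fintype.card_fin] at this
  rw [← this]
  refine integral_congr_ae ?_
  filter_upwards [tpow_coeFn f n, tpow_coeFn g n] with x h1 h2
  rw [h1, h2, map_prod, Finset.prod_mul_distrib]

theorem expVec_apply (f : Lp ℂ 2 μ) (n : ℕ) : ((expVec f n : symPow μ n) : L2Pow μ n) =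
    ((Real.sqrt n.factorial : ℂ))⁻¹ • (tpow f n : L2Pow μ n) := rfl

theorem inner_expVec (f g : Lp ℂ 2 μ) : ⟪expVec f, expVec g⟫_ℂ = Complex.exp ⟪f, g⟫_ℂ := by
  refine (lp.hasSum_inner (expVec f) (expVec g)).unique ?_
  have h := NormedSpace.expSeries_div_hasSum_exp (𝔸 := ℂ) ⟪f, g⟫_ℂ
  rw [← Complex.exp_eq_exp_ℂ] at h
  refine h.congr_fun fun n => ?_
  have h1 : (Real.sqrt n.factorial : ℂ) * Real.sqrt n.factorial = n.factorial := by
    rw [← Complex.ofReal_mul, Real.mul_self_sqrt (Nat.cast_nonneg _)]; simp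
  rw [Submodule.coe_inner, expVec_apply, expVec_apply, inner_smul_left, inner_smul_right,
    ← Submodule.coe_inner, inner_tpow, ← h1]
  simp only [map_inv₀, Complex.conj_ofReal]
  field_simp

theorem norm_sq_expVec_sub (f g : Lp ℂ 2 μ) :
    ‖expVec f - expVec g‖ ^ 2 = (Complex.exp ⟪f, f⟫_ℂ - Complex.exp ⟪f, g⟫_ℂ -
      Complex.exp ⟪g, f⟫_ℂ + Complex.exp ⟪g, g⟫_ℂ).re := by
  rw [← inner_self_eq_norm_sq (𝕜 := ℂ), inner_sub_left, inner_sub_right, inner_sub_right,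
    inner_expVec, inner_expVec, inner_expVec, inner_expVec, sub_sub_eq_add_sub, sub_right_comm]
  simp only [RCLike.re_eq_complex_re, Complex.sub_re, Complex.add_re]
  ring

/-- The map `e` is continuous: `‖e(f) - e(g)‖²` is a continuous expression in inner products. -/
theorem continuous_expVec : Continuous (expVec : Lp ℂ 2 μ → Fock μ) := by
  rw [continuous_iff_continuousAt]
  intro f
  rw [ContinuousAt, tendsto_iff_norm_sub_tendsto_zero]
  have h : Filter.Tendsto (fun g : Lp ℂ 2 μ => ‖expVec g - expVec f‖ ^ 2) (nhds f) (nhds 0) := by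
    simp_rw [norm_sq_expVec_sub]
    have hc : Continuous fun g : Lp ℂ 2 μ => (Complex.exp ⟪g, g⟫_ℂ - Complex.exp ⟪g, f⟫_ℂ -
      Complex.exp ⟪f, g⟫_ℂ + Complex.exp ⟪f, f⟫_ℂ).re := by fun_prop
    simpa using hc.tendsto f
  simpa using h.sqrt

/-! ### Totality of the exponential vectors -/

theorem memLp_prod_apply' {n : ℕ} (f : Fin n → Lp ℂ 2 μ) :
    MemLp (fun x : Fin n → α => ∏ i, f i (x i)) 2 (Measure.pi fun _ : Fin n => μ) := by
  have hm : AEStronglyMeasurable (fun x : Fin n → α => ∏ i, f i (x i))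
      (Measure.pi fun _ : Fin n => μ) := by
    refine Finset.aestronglyMeasurable_fun_prod _ fun i _ => ?_
    exact ((Lp.stronglyMeasurable (f i)).comp_measurable
      (measurable_pi_apply i)).aestronglyMeasurable
  rw [memLp_two_iff_integrable_sq_norm hm]
  have := Integrable.fintype_prod (ι := Fin n) (μ := fun _ => μ) (f := fun i x => ‖f i x‖ ^ 2)
    fun i => (memLp_two_iff_integrable_sq_norm (Lp.aestronglyMeasurable (f i))).mp (Lp.memLp _)
  simpa [norm_prod, Finset.prod_pow] using this

/-- The product function `f₁ ⊗ ⋯ ⊗ fₙ` in `L²(μⁿ)`. -/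
def prodFun {n : ℕ} (f : Fin n → Lp ℂ 2 μ) : L2Pow μ n := (memLp_prod_apply' f).toLp

theorem prodFun_coeFn {n : ℕ} (f : Fin n → Lp ℂ 2 μ) :
    (prodFun f : (Fin n → α) → ℂ) =ᵐ[Measure.pi fun _ => μ] fun x => ∏ i, f i (x i) :=
  (memLp_prod_apply' f).coeFn_toLp

/-- A complex density that integrates to zero over every box integrates to zero over every
measurable set, by the `π`-`λ` theorem. -/
theorem setIntegral_eq_zero_of_boxes {n : ℕ} {ν : Measure (Fin n → α)} {φ : (Fin n → α) → ℂ}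
    (hφ : Integrable φ ν)
    (h : ∀ A : Fin n → Set α, (∀ i, MeasurableSet (A i)) → ∫ x in univ.pi A, φ x ∂ν = 0)
    {s : Set (Fin n → α)} (hs : MeasurableSet s) : ∫ x in s, φ x ∂ν = 0 := by
  have h0 : ∫ x, φ x ∂ν = 0 := by
    simpa using h (fun _ => univ) fun _ => MeasurableSet.univ
  refine MeasurableSpace.induction_on_inter (C := fun s _ => ∫ x in s, φ x ∂ν = 0)
    generateFrom_pi.symm isPiSystem_pi (by simp) ?_ ?_ ?_ s hs
  · rintro _ ⟨A, hA, rfl⟩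
    exact h A fun i => hA i (mem_univ i)
  · intro t ht ih
    rw [setIntegral_compl ht hφ, h0, ih, sub_zero]
  · intro f hd hm ih
    rw [integral_iUnion hm hd hφ.integrableOn]
    simp [ih]

/-- Product functions are total in `L²(μⁿ)`: boxes generate the product `σ`-algebra. -/
theorem eq_zero_of_inner_prodFun {n : ℕ} {ψ : L2Pow μ n}
    (h : ∀ f : Fin n → Lp ℂ 2 μ, ⟪prodFun f, ψ⟫_ℂ = 0) : ψ = 0 := by
  -- On a box of finite measure `ψ` is integrable, and countably many such boxes cover `αⁿ`.
  let B : (Fin n → ℕ) → Set (Fin n → α) := fun k => univ.pi fun i => spanningSets μ (k i)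
  have hB : ∀ k, MeasurableSet (B k) := fun k =>
    MeasurableSet.univ_pi fun i => measurableSet_spanningSets μ (k i)
  have hBU : ⋃ k, B k = univ := by
    rw [eq_univ_iff_forall]
    intro x
    have : ∀ i, ∃ k, x i ∈ spanningSets μ k := fun i => by
      have h : x i ∈ ⋃ k, spanningSets μ k := by rw [iUnion_spanningSets]; trivial
      exact mem_iUnion.mp h
    choose k hk using this
    exact mem_iUnion.mpr ⟨k, fun i _ => hk i⟩
  have hB' : ∀ k, (Measure.pi fun _ : Fin n => μ) (B k) < ∞ := fun k => by
    rw [Measure.pi_pi]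
    exact ENNReal.prod_lt_top fun i _ => measure_spanningSets_lt_top μ (k i)
  have key : ∀ k, ∀ᵐ x ∂((Measure.pi fun _ : Fin n => μ).restrict (B k)), ψ x = 0 := by
    intro k
    have : IsFiniteMeasure ((Measure.pi fun _ : Fin n => μ).restrict (B k)) :=
      ⟨by simpa using hB' k⟩
    have hint : Integrable ψ ((Measure.pi fun _ : Fin n => μ).restrict (B k)) :=
      ((Lp.memLp ψ).restrict (B k)).integrable (by norm_num)
    refine hint.ae_eq_zero_of_forall_setIntegral_eq_zero fun s hs _ => ?_
    refine setIntegral_eq_zero_of_boxes hint (fun A hA => ?_) hs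
    have hm : ∀ i, MeasurableSet (A i ∩ spanningSets μ (k i)) := fun i =>
      (hA i).inter (measurableSet_spanningSets μ (k i))
    have hf : ∀ i, μ (A i ∩ spanningSets μ (k i)) ≠ ∞ := fun i =>
      (measure_mono inter_subset_right).trans_lt (measure_spanningSets_lt_top μ (k i)) |>.ne
    have h1 := h fun i => indicatorConstLp 2 (hm i) (hf i) (1 : ℂ)
    rw [inner_eq_integral] at h1
    rw [Measure.restrict_restrict (MeasurableSet.univ_pi hA), ← pi_inter_distrib,
      ← integral_indicator (MeasurableSet.univ_pi hm), ← h1]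
    refine integral_congr_ae ?_
    have h2 : ∀ᵐ x ∂(Measure.pi fun _ : Fin n => μ), ∀ i,
        indicatorConstLp 2 (hm i) (hf i) (1 : ℂ) (x i) =
          (A i ∩ spanningSets μ (k i)).indicator (fun _ => (1 : ℂ)) (x i) := by
      rw [ae_all_iff]
      intro i
      exact (Measure.quasiMeasurePreserving_eval (fun _ : Fin n => μ) i).ae
        (indicatorConstLp_coeFn (p := 2) (hs := hm i) (hμs := hf i) (c := (1 : ℂ)))
    filter_upwards [prodFun_coeFn fun i => indicatorConstLp 2 (hm i) (hf i) (1 : ℂ), h2]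
      with x hx1 hx2
    rw [hx1]
    simp only [hx2, indicator, mem_univ_pi]
    by_cases hx : ∀ i, x i ∈ A i ∩ spanningSets μ (k i)
    · simp [hx]
    · obtain ⟨i, hi⟩ := not_forall.mp hx
      rw [if_neg (by rwa [mem_univ_pi]), Finset.prod_eq_zero (Finset.mem_univ i) (if_neg hi)]
      simp
  have hU := (ae_restrict_iUnion_iff B fun x => ψ x = 0).mpr key
  rw [hBU, Measure.restrict_univ] at hU
  exact (Lp.eq_zero_iff_ae_eq_zero).mpr hU

/-- Ryser's formula for the permanent, the polarisation identity behind totality. -/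
theorem sum_neg_one_pow_mul_prod_sum {n : ℕ} (z : Fin n → Fin n → ℂ) :
    ∑ s : Finset (Fin n), (-1 : ℂ) ^ s.card * ∏ i, ∑ j ∈ s, z j i =
      (-1) ^ n * ∑ σ : Equiv.Perm (Fin n), ∏ i, z (σ i) i := by
  -- Expand the products over maps `r : Fin n → Fin n` with values in `s`.
  have h1 : ∀ s : Finset (Fin n), ∏ i, ∑ j ∈ s, z j i =
      ∑ r : Fin n → Fin n, (if ∀ i, r i ∈ s then 1 else 0) * ∏ i, z (r i) i := fun s => by
    rw [Finset.prod_univ_sum]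
    simp only [ite_mul, one_mul, zero_mul]
    rw [← Finset.sum_filter]
    refine Finset.sum_congr ?_ fun _ _ => rfl
    ext r
    simp [Fintype.mem_piFinset]
  -- The signed number of sets `s` containing the range of `r` is `∏ⱼ (-1 + [j ∉ range r])`, which
  -- vanishes unless `r` is surjective.
  have h2 : ∀ r : Fin n → Fin n,
      ∑ s : Finset (Fin n), (-1 : ℂ) ^ s.card * (if ∀ i, r i ∈ s then 1 else 0) =
        if Function.Bijective r then (-1) ^ n else 0 := fun r => by
    have := Finset.prod_add (fun _ : Fin n => (-1 : ℂ)) (fun j => if j ∈ range r then 0 else 1)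
      Finset.univ
    rw [Finset.powerset_univ] at this
    have h3 : ∀ s : Finset (Fin n), (∏ _i ∈ s, (-1 : ℂ)) *
        ∏ j ∈ Finset.univ \ s, (if j ∈ range r then (0 : ℂ) else 1) =
        (-1 : ℂ) ^ s.card * (if ∀ i, r i ∈ s then 1 else 0) := fun s => by
      rw [Finset.prod_const]
      congr 1
      split_ifs with hr
      · refine Finset.prod_eq_one fun j hj => if_neg ?_
        rintro ⟨i, rfl⟩
        simp [hr i] at hj
      · obtain ⟨i, hi⟩ := not_forall.mp hr
        exact Finset.prod_eq_zero (i := r i) (by simp [hi]) (if_pos ⟨i, rfl⟩)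
    rw [← Finset.sum_congr rfl fun s _ => h3 s, ← this]
    split_ifs with hr
    · simp [hr.2.range_eq]
    · rw [← Finite.surjective_iff_bijective] at hr
      obtain ⟨j, hj⟩ := not_forall.mp hr
      refine Finset.prod_eq_zero (Finset.mem_univ j) ?_
      rw [if_neg (by simpa using hj)]
      simp
  calc ∑ s : Finset (Fin n), (-1 : ℂ) ^ s.card * ∏ i, ∑ j ∈ s, z j i
      = ∑ r : Fin n → Fin n, (if Function.Bijective r then (-1) ^ n else 0) * ∏ i, z (r i) i := by
        simp_rw [h1, Finset.mul_sum]
        rw [Finset.sum_comm]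
        refine Finset.sum_congr rfl fun r _ => ?_
        rw [← h2, Finset.sum_mul]
        exact Finset.sum_congr rfl fun s _ => by ring
    _ = ∑ r : Fin n → Fin n with Function.Bijective r, (-1) ^ n * ∏ i, z (r i) i := by
        rw [Finset.sum_filter]
        exact Finset.sum_congr rfl fun r _ => by split_ifs <;> simp
    _ = _ := by
        rw [Finset.mul_sum]
        refine Finset.sum_bij' (fun r hr => Equiv.ofBijective r (Finset.mem_filter.mp hr).2)
          (fun σ _ => σ) ?_ ?_ ?_ ?_ ?_
        · simp
        · intro σ _; exact Finset.mem_filter.mpr ⟨Finset.mem_univ _, σ.bijective⟩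
        · intro r hr; rfl
        · intro σ _; ext; rfl
        · intro r hr; rfl

/-- Pairings with a symmetric function do not depend on the order of the factors. -/
theorem inner_prodFun_perm {n : ℕ} (f : Fin n → Lp ℂ 2 μ) (ψ : symPow μ n)
    (σ : Equiv.Perm (Fin n)) :
    ⟪prodFun (f ∘ σ), (ψ : L2Pow μ n)⟫_ℂ = ⟪prodFun f, (ψ : L2Pow μ n)⟫_ℂ := by
  -- `permAct` relabels the coordinates, so it permutes the factors by the inverse.
  have h : permAct μ σ.symm (prodFun f) = prodFun (f ∘ σ) := by
    change Lp.compMeasurePreserving _ (measurePreserving_perm μ σ.symm) _ = _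
    rw [prodFun, Lp.toLp_compMeasurePreserving, prodFun, MemLp.toLp_eq_toLp_iff]
    refine Filter.Eventually.of_forall fun x => ?_
    simp only [Function.comp_apply]
    exact (Fintype.prod_equiv σ _ _ fun i => by simp).symm
  rw [← h]
  conv_lhs => rw [← ψ.2 σ.symm]
  exact (permAct μ σ.symm).inner_map_map _ _

/-- Tensor powers are total in the symmetric subspace, by polarisation. -/
theorem eq_zero_of_inner_tpow {n : ℕ} {ψ : symPow μ n} (h : ∀ f, ⟪tpow f n, ψ⟫_ℂ = 0) : ψ = 0 := by
  refine Subtype.ext (eq_zero_of_inner_prodFun fun f => ?_)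
  have hR : ∑ s : Finset (Fin n), (-1 : ℂ) ^ s.card • (tpow (∑ j ∈ s, f j) n : L2Pow μ n) =
      (-1 : ℂ) ^ n • ∑ σ : Equiv.Perm (Fin n), prodFun (f ∘ σ) := by
    have hs : ∀ s : Finset (Fin n), ∀ᵐ x ∂(Measure.pi fun _ : Fin n => μ),
        ((-1 : ℂ) ^ s.card • (tpow (∑ j ∈ s, f j) n : L2Pow μ n) : L2Pow μ n) x =
          (-1 : ℂ) ^ s.card * ∏ i, ∑ j ∈ s, f j (x i) := fun s => by
      have h1 : ∀ᵐ x ∂(Measure.pi fun _ : Fin n => μ), ∀ i,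
          (∑ j ∈ s, f j : Lp ℂ 2 μ) (x i) = ∑ j ∈ s, f j (x i) := by
        rw [ae_all_iff]
        intro i
        have h : ∀ᵐ x ∂μ, (∑ j ∈ s, f j : Lp ℂ 2 μ) x = ∑ j ∈ s, f j x := by
          filter_upwards [Lp.coeFn_finsetSum s f] with x hx
          simpa using hx
        exact (Measure.quasiMeasurePreserving_eval (fun _ : Fin n => μ) i).ae h
      filter_upwards [Lp.coeFn_smul ((-1 : ℂ) ^ s.card) (tpow (∑ j ∈ s, f j) n : L2Pow μ n),
        tpow_coeFn (∑ j ∈ s, f j) n, h1] with x h2 h3 h4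
      rw [h2, Pi.smul_apply, h3, smul_eq_mul]
      simp only [h4]
    have hp : ∀ᵐ x ∂(Measure.pi fun _ : Fin n => μ), ∀ σ : Equiv.Perm (Fin n),
        prodFun (f ∘ σ) x = ∏ i, f (σ i) (x i) :=
      ae_all_iff.mpr fun σ => prodFun_coeFn (f ∘ σ)
    refine Lp.ext ?_
    filter_upwards [Lp.coeFn_finsetSum Finset.univ fun s : Finset (Fin n) =>
        ((-1 : ℂ) ^ s.card • (tpow (∑ j ∈ s, f j) n : L2Pow μ n) : L2Pow μ n), ae_all_iff.mpr hs,
      Lp.coeFn_smul ((-1 : ℂ) ^ n) (∑ σ : Equiv.Perm (Fin n), prodFun (f ∘ σ)),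
      Lp.coeFn_finsetSum Finset.univ fun σ : Equiv.Perm (Fin n) => prodFun (f ∘ σ), hp]
      with x h1 h2 h3 h4 h5
    rw [h1, h3, Pi.smul_apply, h4, smul_eq_mul, Finset.sum_apply, Finset.sum_apply]
    simp only [h2, h5]
    exact sum_neg_one_pow_mul_prod_sum fun j i => f j (x i)
  have h1 := congrArg (fun φ => ⟪φ, (ψ : L2Pow μ n)⟫_ℂ) hR
  have h2 : ∀ g, ⟪(tpow g n : L2Pow μ n), (ψ : L2Pow μ n)⟫_ℂ = 0 := fun g => h g
  simp only [sum_inner, inner_smul_left, h2, inner_prodFun_perm] at h1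
  simpa [Nat.factorial_ne_zero] using h1.symm

theorem tpow_smul (z : ℂ) (f : Lp ℂ 2 μ) (n : ℕ) : tpow (z • f) n = z ^ n • tpow f n := by
  refine Subtype.ext (Lp.ext ?_)
  have h1 : ∀ᵐ x ∂(Measure.pi fun _ : Fin n => μ), ∀ i, (z • f : Lp ℂ 2 μ) (x i) = z * f (x i) := by
    rw [ae_all_iff]
    intro i
    exact (Measure.quasiMeasurePreserving_eval (fun _ : Fin n => μ) i).ae (Lp.coeFn_smul z f)
  filter_upwards [tpow_coeFn (z • f) n, tpow_coeFn f n,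
    Lp.coeFn_smul (z ^ n) (tpow f n : L2Pow μ n), h1] with x h2 h3 h4 h5
  rw [h2, Submodule.coe_smul, h4, Pi.smul_apply, h3]
  simp [h5, Finset.prod_mul_distrib]

/-- The exponential vectors are total in the Fock space: the coefficients of `z ↦ ⟪e(z f), ψ⟫`
recover the pairings of the components of `ψ` with the tensor powers of `f`. -/
theorem isTotal_expVec : IsTotal (expVec : Lp ℂ 2 μ → Fock μ) := by
  refine isTotal_of_forall_inner_eq_zero fun ψ hψ => ?_
  refine lp.ext (funext fun n => eq_zero_of_inner_tpow fun f => ?_)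
  -- The inner product is conjugate linear on the left, so `e(conj w • f)` gives a series in `w`.
  let c : ℕ → ℂ := fun n => ((Real.sqrt n.factorial : ℂ))⁻¹ * ⟪tpow f n, ψ n⟫_ℂ
  have hc : ∀ w : ℂ, HasSum (fun n => w ^ n • c n) 0 := fun w => by
    have h := lp.hasSum_inner (𝕜 := ℂ) (expVec (conj w • f)) ψ
    rw [hψ] at h
    refine h.congr_fun fun n => ?_
    rw [Submodule.coe_inner, expVec_apply, tpow_smul, Submodule.coe_smul, inner_smul_left,
      inner_smul_left]
    simp only [c, Submodule.coe_inner, smul_eq_mul, map_inv₀, Complex.conj_ofReal, map_pow,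
      Complex.conj_conj]
    ring
  have hp : HasFPowerSeriesAt (fun _ : ℂ => (0 : ℂ)) (FormalMultilinearSeries.ofScalars ℂ c) 0 := by
    rw [hasFPowerSeriesAt_iff]
    exact Filter.Eventually.of_forall fun w => by
      simpa [FormalMultilinearSeries.coeff_ofScalars] using hc w
  have h0 := congrArg (fun p => FormalMultilinearSeries.coeff p n) hp.eq_zero
  have h1 : c n = 0 := by
    rw [FormalMultilinearSeries.coeff_ofScalars] at h0
    exact h0
  have h2 : (Real.sqrt n.factorial : ℂ) ≠ 0 := by
    exact_mod_cast (Real.sqrt_pos.mpr (Nat.cast_pos.mpr n.factorial_pos)).ne'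
  exact (mul_eq_zero.mp h1).resolve_left (inv_ne_zero h2)

end Fock

/-! ### Primitives of integrable functions -/

section Calculus

open Filter Topology

theorem continuous_integral_Ici {φ : ℝ → ℂ} (hφ : Integrable φ) :
    Continuous fun s => ∫ x in Ici s, φ x := by
  have h : (fun s => ∫ x in Ici s, φ x) =
      fun s => (∫ x in Ioi (0 : ℝ), φ x) - ∫ x in (0 : ℝ)..s, φ x := by
    ext s
    rw [integral_Ici_eq_integral_Ioi, ← intervalIntegral.integral_interval_add_Ioi
      (hφ.integrableOn (s := Ioi (0 : ℝ))) (hφ.integrableOn (s := Ioi s)), add_sub_cancel_left]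
  rw [h]
  exact continuous_const.sub (intervalIntegral.continuous_primitive
    (fun a b => hφ.intervalIntegrable) 0)

theorem integrable_exp_mul {φ ψ : ℝ → ℂ} (hφ : Integrable φ) (hψ : Integrable ψ) :
    Integrable fun s => Complex.exp (∫ x in Ici s, φ x) * ψ s := by
  refine hψ.bdd_mul (c := Real.exp (∫ x, ‖φ x‖))
    (Complex.continuous_exp.comp (continuous_integral_Ici hφ)).aestronglyMeasurable
    (Eventually.of_forall fun s => ?_)
  refine (Complex.norm_exp_le_exp_norm _).trans (Real.exp_le_exp.mpr ?_)
  exact (norm_integral_le_integral_norm _).trans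
    (setIntegral_le_integral hφ.norm (Eventually.of_forall fun x => norm_nonneg _))

theorem integral_exp_mul_of_continuous {φ : ℝ → ℂ} (hφ : Integrable φ) (hc : Continuous φ)
    (a : ℝ) : ∫ s in Ici a, Complex.exp (∫ x in Ici s, φ x) * φ s =
      Complex.exp (∫ x in Ici a, φ x) - 1 := by
  have hI : ∀ s, ∫ x in Ici s, φ x = (∫ x in Ioi a, φ x) - ∫ x in a..s, φ x := fun s => by
    rw [integral_Ici_eq_integral_Ioi, ← intervalIntegral.integral_interval_add_Ioi
      (hφ.integrableOn (s := Ioi a)) (hφ.integrableOn (s := Ioi s)), add_sub_cancel_left]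
  have hd : ∀ s, HasDerivAt (fun s => -Complex.exp (∫ x in Ici s, φ x))
      (Complex.exp (∫ x in Ici s, φ x) * φ s) s := fun s => by
    simp only [hI]
    have h1 : HasDerivAt (fun s => ∫ x in a..s, φ x) (φ s) s :=
      intervalIntegral.integral_hasDerivAt_right hφ.intervalIntegrable
        (hc.stronglyMeasurableAtFilter _ _) hc.continuousAt
    exact ((h1.const_sub (∫ x in Ioi a, φ x)).cexp).neg.congr_deriv (by simp)
  have ht : Tendsto (fun s => -Complex.exp (∫ x in Ici s, φ x)) atTop (𝓝 (-1)) := by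
    simp only [hI]
    have h1 := intervalIntegral_tendsto_integral_Ioi a (hφ.integrableOn (s := Ioi a)) tendsto_id
    have h2 := ((Complex.continuous_exp.tendsto _).comp
      ((tendsto_const_nhds (x := ∫ x in Ioi a, φ x)).sub h1)).neg
    simpa using h2
  rw [integral_Ici_eq_integral_Ioi, integral_Ioi_of_hasDerivAt_of_tendsto'
    (fun s _ => hd s) (integrable_exp_mul hφ hφ).integrableOn ht]
  ring

/-- The fundamental theorem of calculus for `s ↦ exp (∫_s^∞ φ)` with `φ` merely integrable, by
approximation of `φ` in `L¹` by continuous functions. -/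
theorem integral_exp_mul {φ : ℝ → ℂ} (hφ : Integrable φ) (a : ℝ) :
    ∫ s in Ici a, Complex.exp (∫ x in Ici s, φ x) * φ s =
      Complex.exp (∫ x in Ici a, φ x) - 1 := by
  choose γ _ hγε hγc hγi using fun n : ℕ =>
    hφ.exists_hasCompactSupport_integral_sub_le (ε := 1 / ((n : ℝ) + 1)) (by positivity)
  have hε : Tendsto (fun n => ∫ x, ‖φ x - γ n x‖) atTop (𝓝 0) :=
    squeeze_zero (fun n => integral_nonneg fun x => norm_nonneg _) hγε
      tendsto_one_div_add_atTop_nhds_zero_nat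
  have hΦ : ∀ s, Tendsto (fun n => ∫ x in Ici s, γ n x) atTop (𝓝 (∫ x in Ici s, φ x)) := fun s => by
    rw [tendsto_iff_norm_sub_tendsto_zero]
    refine squeeze_zero (fun n => norm_nonneg _) (fun n => ?_) hε
    rw [norm_sub_rev, ← integral_sub hφ.integrableOn (hγi n).integrableOn]
    exact (norm_integral_le_integral_norm _).trans
      (setIntegral_le_integral (hφ.sub (hγi n)).norm (Eventually.of_forall fun x => norm_nonneg _))
  have hbd : ∀ n s, ‖Complex.exp (∫ x in Ici s, γ n x)‖ ≤ Real.exp ((∫ x, ‖φ x‖) + 1) := by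
    intro n s
    refine (Complex.norm_exp_le_exp_norm _).trans (Real.exp_le_exp.mpr ?_)
    calc ‖∫ x in Ici s, γ n x‖ ≤ ∫ x in Ici s, ‖γ n x‖ := norm_integral_le_integral_norm _
      _ ≤ ∫ x, ‖γ n x‖ :=
        setIntegral_le_integral (hγi n).norm (Eventually.of_forall fun x => norm_nonneg _)
      _ ≤ ∫ x, (‖φ x‖ + ‖φ x - γ n x‖) := by
        refine integral_mono (hγi n).norm (hφ.norm.add (hφ.sub (hγi n)).norm) fun x => ?_
        simpa [norm_sub_rev] using norm_le_norm_add_norm_sub (φ x) (γ n x)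
      _ = (∫ x, ‖φ x‖) + ∫ x, ‖φ x - γ n x‖ := integral_add hφ.norm (hφ.sub (hγi n)).norm
      _ ≤ _ := by
        gcongr
        refine (hγε n).trans ?_
        rw [div_le_one (by positivity)]
        linarith [(Nat.cast_nonneg n : (0 : ℝ) ≤ n)]
  -- Replace `γ n` by `φ` outside the exponential, where dominated convergence applies, and bound
  -- the remaining term by the `L¹` distance.
  have h1 : Tendsto (fun n => ∫ s in Ici a, Complex.exp (∫ x in Ici s, γ n x) * φ s) atTop
      (𝓝 (∫ s in Ici a, Complex.exp (∫ x in Ici s, φ x) * φ s)) := by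
    refine tendsto_integral_of_dominated_convergence
      (fun s => Real.exp ((∫ x, ‖φ x‖) + 1) * ‖φ s‖)
      (fun n => (integrable_exp_mul (hγi n) hφ).integrableOn.aestronglyMeasurable)
      (hφ.norm.const_mul _).integrableOn
      (fun n => Eventually.of_forall fun s => ?_) (Eventually.of_forall fun s => ?_)
    · rw [norm_mul]
      gcongr
      exact hbd n s
    · exact ((Complex.continuous_exp.tendsto _).comp (hΦ s)).mul_const _
  have h2 : Tendsto (fun n => ∫ s in Ici a, Complex.exp (∫ x in Ici s, γ n x) * (φ s - γ n s))
      atTop (𝓝 0) := by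
    have hε' := hε.const_mul (Real.exp ((∫ x, ‖φ x‖) + 1))
    rw [mul_zero] at hε'
    refine squeeze_zero_norm (fun n => ?_) hε'
    refine (norm_integral_le_integral_norm _).trans ?_
    refine (setIntegral_le_integral (integrable_exp_mul (hγi n) (hφ.sub (hγi n))).norm
      (Eventually.of_forall fun x => norm_nonneg _)).trans ?_
    rw [← integral_const_mul]
    refine integral_mono (integrable_exp_mul (hγi n) (hφ.sub (hγi n))).norm
      ((hφ.sub (hγi n)).norm.const_mul _) fun s => ?_
    simp only [norm_mul]
    exact mul_le_mul_of_nonneg_right (hbd n s) (norm_nonneg _)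
  have h3 : Tendsto (fun n => Complex.exp (∫ x in Ici a, γ n x) - 1) atTop
      (𝓝 (Complex.exp (∫ x in Ici a, φ x) - 1)) :=
    ((Complex.continuous_exp.tendsto _).comp (hΦ a)).sub_const _
  have h12 := h1.sub h2
  rw [sub_zero] at h12
  refine tendsto_nhds_unique (h12.congr fun n => ?_) h3
  have hi : Integrable fun s => Complex.exp (∫ x in Ici s, γ n x) * (φ s - γ n s) :=
    integrable_exp_mul (hγi n) (hφ.sub (hγi n))
  rw [← integral_exp_mul_of_continuous (hγi n) (hγc n), ← integral_sub
    (integrable_exp_mul (hγi n) hφ).integrableOn hi.integrableOn]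
  refine integral_congr_ae (Eventually.of_forall fun s => ?_)
  simp only
  ring

end Calculus

/-! ### The shift and its adjoint -/

section Shift

theorem measurePreserving_add_Ici (t : ℝ≥0) : MeasurePreserving (fun x : ℝ => x + t)
    (volume.restrict (Ici (0 : ℝ))) (volume.restrict (Ici (t : ℝ))) := by
  have := (measurePreserving_add_right (volume : Measure ℝ) (t : ℝ)).restrict_preimage
    (measurableSet_Ici (a := (t : ℝ)))
  convert this using 2
  simp

theorem setIntegral_Ici_comp_add (t : ℝ≥0) (φ : ℝ → ℂ) :
    ∫ x in Ici (0 : ℝ), φ (x + t) = ∫ x in Ici (t : ℝ), φ x :=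
  (measurePreserving_add_Ici t).integral_comp (measurableEmbedding_addRight _) φ

theorem ae_Ici_comp_add (t : ℝ≥0) {p : ℝ → Prop}
    (h : ∀ᵐ x ∂(volume.restrict (Ici (0 : ℝ))), p x) :
    ∀ᵐ x ∂(volume.restrict (Ici (0 : ℝ))), p (x + t) :=
  (measurePreserving_add_Ici t).quasiMeasurePreserving.ae
    (ae_restrict_of_ae_restrict_of_subset (Ici_subset_Ici.mpr t.2) h)

theorem S_coeFn (t : ℝ≥0) (f : L2R) :
    (S t f : ℝ → ℂ) =ᵐ[volume.restrict (Ici (0 : ℝ))] shiftFun t f :=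
  (memLp_shiftFun t f).coeFn_toLp

/-- The strict inequality in `shiftFun` only excludes a null set. -/
theorem setIntegral_Ici_ite (t : ℝ≥0) (φ : ℝ → ℂ) :
    ∫ x in Ici (0 : ℝ), (if (t : ℝ) < x then φ x else 0) = ∫ x in Ici (t : ℝ), φ x := by
  have h : (fun x => if (t : ℝ) < x then φ x else 0) = (Ioi (t : ℝ)).indicator φ := by
    ext x; simp [indicator]
  rw [h, setIntegral_indicator measurableSet_Ioi, inter_eq_right.mpr, integral_Ici_eq_integral_Ioi]
  exact fun x hx => t.2.trans (le_of_lt hx)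

theorem memLp_comp_add (t : ℝ≥0) (g : L2R) :
    MemLp (fun x => g (x + t)) 2 (volume.restrict (Ici (0 : ℝ))) :=
  ((Lp.memLp g).mono_measure (Measure.restrict_mono (Ici_subset_Ici.mpr t.2) le_rfl)
    ).comp_measurePreserving (measurePreserving_add_Ici t)

/-- The adjoint of the right shift is the left shift. -/
theorem Sadj_coeFn (t : ℝ≥0) (g : L2R) :
    (Sadj t g : ℝ → ℂ) =ᵐ[volume.restrict (Ici (0 : ℝ))] fun x => g (x + t) := by
  have h : Sadj t g = (memLp_comp_add t g).toLp := by
    refine ext_inner_left ℂ fun f => ?_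
    rw [Sadj, ContinuousLinearMap.adjoint_inner_right, inner_eq_integral, inner_eq_integral]
    calc ∫ x in Ici (0 : ℝ), conj (S t f x) * g x
        = ∫ x in Ici (0 : ℝ), (if (t : ℝ) < x then conj (f (x - t)) * g x else 0) := by
          refine integral_congr_ae ?_
          filter_upwards [S_coeFn t f] with x hx
          rw [hx, shiftFun]
          split_ifs <;> simp
      _ = ∫ x in Ici (0 : ℝ), conj (f x) * g (x + t) := by
          rw [setIntegral_Ici_ite, ← setIntegral_Ici_comp_add]
          simp
      _ = _ := by
          refine integral_congr_ae ?_
          filter_upwards [(memLp_comp_add t g).coeFn_toLp] with x hx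
          rw [hx]
  rw [h]
  exact (memLp_comp_add t g).coeFn_toLp

theorem inner_Sadj_Sadj (t : ℝ≥0) (f g : L2R) :
    ⟪Sadj t f, Sadj t g⟫_ℂ = ∫ x in Ici (t : ℝ), conj (f x) * g x := by
  rw [inner_eq_integral, ← setIntegral_Ici_comp_add]
  refine integral_congr_ae ?_
  filter_upwards [Sadj_coeFn t f, Sadj_coeFn t g] with x h1 h2
  rw [h1, h2]

theorem inner_S_S (t : ℝ≥0) (f g : L2R) : ⟪S t f, S t g⟫_ℂ = ⟪f, g⟫_ℂ :=
  (shift t).inner_map_map f g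

@[simp] theorem norm_S (t : ℝ≥0) (f : L2R) : ‖S t f‖ = ‖f‖ := (shift t).norm_map f

theorem Sadj_S (t : ℝ≥0) (f : L2R) : Sadj t (S t f) = f :=
  ext_inner_left ℂ fun g => by rw [Sadj, ContinuousLinearMap.adjoint_inner_right, inner_S_S]

theorem S_S (s t : ℝ≥0) (f : L2R) : S s (S t f) = S (s + t) f := by
  refine Lp.ext ?_
  filter_upwards [(S_coeFn s (S t f)).trans (shiftFun_congr s (S_coeFn t f)), S_coeFn (s + t) f]
    with x h1 h2
  rw [h1, h2]
  have ht : (0 : ℝ) ≤ t := t.2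
  have hst : ((s + t : ℝ≥0) : ℝ) = s + t := NNReal.coe_add s t
  simp only [shiftFun]
  by_cases h3 : ((s + t : ℝ≥0) : ℝ) < x
  · rw [if_pos h3, if_pos (by linarith), if_pos (by linarith), hst, sub_sub]
  · rw [if_neg h3, if_neg (by linarith : ¬ (t : ℝ) < x - s), ite_self]

theorem S_zero (f : L2R) : S 0 f = f := by
  refine Lp.ext ?_
  have h : ∀ᵐ x ∂(volume.restrict (Ici (0 : ℝ))), x ≠ (0 : ℝ) :=
    ae_restrict_of_ae (Measure.ae_ne volume 0)
  filter_upwards [S_coeFn 0 f, h, ae_restrict_mem measurableSet_Ici] with x h1 h2 h3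
  have : 0 < x := lt_of_le_of_ne h3 h2.symm
  simp [h1, shiftFun, this]

theorem Sadj_Sadj (s t : ℝ≥0) (f : L2R) : Sadj s (Sadj t f) = Sadj (s + t) f :=
  ext_inner_left ℂ fun g => by
    simp only [Sadj, ContinuousLinearMap.adjoint_inner_right, S_S, add_comm t s]

theorem Sadj_zero (f : L2R) : Sadj 0 f = f :=
  ext_inner_left ℂ fun g => by
    simp only [Sadj, ContinuousLinearMap.adjoint_inner_right, S_zero]

theorem Sadj_S_of_le {s t : ℝ≥0} (h : s ≤ t) (f : L2R) : Sadj s (S t f) = S (t - s) f := by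
  rw [← add_tsub_cancel_of_le h, ← S_S, Sadj_S, add_tsub_cancel_left]

theorem Sadj_add_S (s t : ℝ≥0) (f : L2R) : Sadj (s + t) (S t f) = Sadj s f := by
  rw [← Sadj_Sadj, Sadj_S]

theorem Sadj_sub_Sadj {s t : ℝ≥0} (h : s ≤ t) (f : L2R) : Sadj (t - s) (Sadj s f) = Sadj t f := by
  rw [Sadj_Sadj, tsub_add_cancel_of_le h]

/-- Strong continuity of the left shifts, which restrict translations on `L²(ℝ)` to the half-line. -/
theorem continuous_Sadj (f : L2R) : Continuous fun t : ℝ≥0 => Sadj t f := by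
  have hG : MemLp ((Ici (0 : ℝ)).indicator f) 2 volume := by
    rw [memLp_indicator_iff_restrict measurableSet_Ici]
    exact Lp.memLp f
  let τ : ℝ≥0 → C(ℝ, ℝ) := fun t => ⟨fun x => x + t, by fun_prop⟩
  have hτ : Continuous τ :=
    (ContinuousMap.curry ⟨fun p : ℝ≥0 × ℝ => p.2 + p.1, by fun_prop⟩).continuous
  have hm : ∀ t, MeasurePreserving (τ t) (volume : Measure ℝ) volume := fun t =>
    measurePreserving_add_right volume (t : ℝ)
  have hc := (continuous_const (y := hG.toLp)).compMeasurePreservingLp hτ hm (by norm_num)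
  have h : (fun t : ℝ≥0 => Sadj t f) = fun t => LpToLpRestrictCLM ℝ ℂ ℂ volume 2 (Ici (0 : ℝ))
      (Lp.compMeasurePreserving (τ t) (hm t) hG.toLp) := by
    ext1 t
    refine Lp.ext ?_
    have h1 : ∀ᵐ x, (hG.toLp : Lp ℂ 2 volume) (x + t) = (Ici (0 : ℝ)).indicator f (x + t) :=
      (hm t).quasiMeasurePreserving.ae hG.coeFn_toLp
    filter_upwards [Sadj_coeFn t f, LpToLpRestrictCLM_coeFn ℂ (Ici (0 : ℝ))
      (Lp.compMeasurePreserving (τ t) (hm t) hG.toLp), ae_restrict_of_ae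
      (Lp.coeFn_compMeasurePreserving hG.toLp (hm t)), ae_restrict_of_ae h1,
      ae_restrict_mem measurableSet_Ici] with x h2 h3 h4 h5 h6
    rw [h2, h3, h4, Function.comp_apply]
    change _ = (hG.toLp : Lp ℂ 2 volume) (x + t)
    rw [h5, indicator_of_mem]
    exact add_nonneg h6 t.2
  rw [h]
  exact (LpToLpRestrictCLM ℝ ℂ ℂ volume 2 (Ici (0 : ℝ))).continuous.comp hc

/-- Strong continuity of `S_t` at `0`, from that of `S_t*`, as `‖S_t f‖ = ‖f‖`. -/
theorem tendsto_S_zero (f : L2R) : Filter.Tendsto (fun t => S t f) (nhds 0) (nhds f) := by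
  rw [tendsto_iff_norm_sub_tendsto_zero]
  have h : ∀ t, ‖S t f - f‖ ^ 2 = 2 * ‖f‖ ^ 2 - 2 * (⟪f, Sadj t f⟫_ℂ).re := fun t => by
    rw [norm_sub_sq (𝕜 := ℂ), norm_S, Sadj, ContinuousLinearMap.adjoint_inner_right]
    simp only [RCLike.re_eq_complex_re]
    ring
  have h0 : Filter.Tendsto (fun t => ‖S t f - f‖ ^ 2) (nhds 0) (nhds 0) := by
    simp only [h]
    have hc : Continuous fun t => 2 * ‖f‖ ^ 2 - 2 * (⟪f, Sadj t f⟫_ℂ).re := by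
      have := continuous_Sadj f
      fun_prop
    have := hc.tendsto 0
    rwa [Sadj_zero, ← RCLike.re_eq_complex_re, inner_self_eq_norm_sq, sub_self] at this
  simpa using h0.sqrt

/-! ### Splitting a function at time `t` -/

theorem memLp_Ioo (t : ℝ≥0) (f : L2R) : MemLp f 2 (volume.restrict (Ioo (0 : ℝ) t)) :=
  (Lp.memLp f).mono_measure
    (Measure.restrict_mono (Ioo_subset_Ioi_self.trans Ioi_subset_Ici_self) le_rfl)

/-- The restriction of `f` to `(0, t)`. -/
def cutoff (t : ℝ≥0) (f : L2R) : L2I t := (memLp_Ioo t f).toLp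

theorem cutoff_coeFn (t : ℝ≥0) (f : L2R) :
    (cutoff t f : ℝ → ℂ) =ᵐ[volume.restrict (Ioo (0 : ℝ) t)] f :=
  (memLp_Ioo t f).coeFn_toLp

theorem extendZero_coeFn (t : ℝ≥0) (f : L2I t) :
    (extendZero t f : ℝ → ℂ) =ᵐ[volume.restrict (Ici (0 : ℝ))] (Ioo (0 : ℝ) t).indicator f :=
  (memLp_indicator_Ioo t f).coeFn_toLp

theorem setIntegral_Ici_indicator_Ioo (t : ℝ≥0) (φ : ℝ → ℂ) :
    ∫ x in Ici (0 : ℝ), (Ioo (0 : ℝ) t).indicator φ x = ∫ x in Ioo (0 : ℝ) t, φ x := by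
  rw [setIntegral_indicator measurableSet_Ioo, inter_eq_right.mpr]
  exact Ioo_subset_Ioi_self.trans Ioi_subset_Ici_self

theorem inner_extendZero (t : ℝ≥0) (f g : L2I t) :
    ⟪extendZero t f, extendZero t g⟫_ℂ = ⟪f, g⟫_ℂ := by
  rw [inner_eq_integral, inner_eq_integral, ← setIntegral_Ici_indicator_Ioo]
  refine integral_congr_ae ?_
  filter_upwards [extendZero_coeFn t f, extendZero_coeFn t g] with x h1 h2
  rw [h1, h2]
  by_cases hx : x ∈ Ioo (0 : ℝ) t <;> simp [hx]

theorem inner_extendZero_S (t : ℝ≥0) (f : L2I t) (g : L2R) :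
    ⟪extendZero t f, S t g⟫_ℂ = 0 := by
  rw [inner_eq_integral]
  refine integral_eq_zero_of_ae ?_
  filter_upwards [extendZero_coeFn t f, S_coeFn t g] with x h1 h2
  rw [h1, h2, shiftFun]
  by_cases hx : x ∈ Ioo (0 : ℝ) t
  · simp [hx.2.not_gt]
  · simp [hx]

/-- The decomposition `L²(ℝ₊) = L²(0, t) ⊕ S_t L²(ℝ₊)` is orthogonal. -/
theorem inner_split (t : ℝ≥0) (f f' : L2I t) (g g' : L2R) :
    ⟪extendZero t f + S t g, extendZero t f' + S t g'⟫_ℂ = ⟪f, f'⟫_ℂ + ⟪g, g'⟫_ℂ := by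
  rw [inner_add_left, inner_add_right, inner_add_right, inner_extendZero, inner_extendZero_S,
    inner_S_S, ← inner_conj_symm (S t g), inner_extendZero_S]
  simp

/-- `f = f 1_{(0, t)} + S_t S_t* f`; the end points `0` and `t` form a null set. -/
theorem extendZero_cutoff_add (t : ℝ≥0) (f : L2R) :
    extendZero t (cutoff t f) + S t (Sadj t f) = f := by
  refine Lp.ext ?_
  have h0 : ∀ᵐ x ∂(volume.restrict (Ici (0 : ℝ))), x ≠ (0 : ℝ) ∧ x ≠ t :=
    ae_restrict_of_ae ((Measure.ae_ne volume 0).and (Measure.ae_ne volume (t : ℝ)))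
  have hcut : ∀ᵐ x ∂(volume.restrict (Ici (0 : ℝ))), x ∈ Ioo (0 : ℝ) t → cutoff t f x = f x :=
    ae_restrict_of_ae ((ae_restrict_iff' measurableSet_Ioo).mp (cutoff_coeFn t f))
  filter_upwards [Lp.coeFn_add (extendZero t (cutoff t f)) (S t (Sadj t f)),
    extendZero_coeFn t (cutoff t f),
    (S_coeFn t (Sadj t f)).trans (shiftFun_congr t (Sadj_coeFn t f)), h0, hcut,
    ae_restrict_mem measurableSet_Ici] with x h1 h2 h3 h4 h5 h6
  rw [h1, Pi.add_apply, h2, h3, shiftFun]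
  have hx0 : 0 < x := lt_of_le_of_ne h6 h4.1.symm
  rcases lt_or_gt_of_ne h4.2 with hx | hx
  · have : x ∈ Ioo (0 : ℝ) t := ⟨hx0, hx⟩
    rw [indicator_of_mem this, h5 this, if_neg hx.not_gt, add_zero]
  · have : x ∉ Ioo (0 : ℝ) t := fun h => hx.not_gt h.2
    rw [indicator_of_notMem this, if_pos hx]
    simp

theorem inner_cutoff (t : ℝ≥0) (f g : L2R) :
    ⟪cutoff t f, cutoff t g⟫_ℂ = ⟪f, g⟫_ℂ - ⟪Sadj t f, Sadj t g⟫_ℂ := by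
  have := inner_split t (cutoff t f) (cutoff t g) (Sadj t f) (Sadj t g)
  rw [extendZero_cutoff_add, extendZero_cutoff_add] at this
  rw [this]
  ring

end Shift

/-! ### `K ⊗ L²(ν)` as a space of vector-valued functions -/

section Field

variable {α K : Type*} [MeasurableSpace α] {ν : Measure α} [NormedAddCommGroup K]
  [InnerProductSpace ℂ K]

theorem memLp_smul_const (η : Lp ℂ 2 ν) (k : K) : MemLp (fun s => η s • k) 2 ν :=
  (Lp.memLp η).of_le_mul (c := ‖k‖) ((Lp.aestronglyMeasurable η).smul_const k)
    (Filter.Eventually.of_forall fun s => by rw [norm_smul, mul_comm])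

theorem memLp_smul_of_bound (f : Lp ℂ 2 ν) {F : α → K} (hF : AEStronglyMeasurable F ν) {C : ℝ}
    (hC : ∀ s, ‖F s‖ ≤ C) : MemLp (fun s => f s • F s) 2 ν :=
  (Lp.memLp f).of_le_mul (c := C) ((Lp.aestronglyMeasurable f).smul hF)
    (Filter.Eventually.of_forall fun s => by
      rw [norm_smul, mul_comm]; exact mul_le_mul_of_nonneg_right (hC s) (norm_nonneg _))

/-- The functions `s ↦ η s • k` are total in `L²(ν; K)`, as they include the indicators. -/
theorem isTotal_smul_const [CompleteSpace K] :
    IsTotal fun p : K × Lp ℂ 2 ν => (memLp_smul_const p.2 p.1).toLp := by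
  refine isTotal_of_forall_inner_eq_zero fun ψ hψ => ?_
  refine ext_inner_left ℂ fun φ => ?_
  rw [inner_zero_right]
  refine Lp.induction (by norm_num) (motive := fun φ => ⟪φ, ψ⟫_ℂ = 0) ?_ ?_ ?_ φ
  · intro c s hs hμs
    have h := hψ (c, indicatorConstLp 2 hs hμs.ne (1 : ℂ))
    have h' : ((memLp_smul_const (indicatorConstLp 2 hs hμs.ne (1 : ℂ)) c).toLp : Lp K 2 ν) =
        Lp.simpleFunc.indicatorConst 2 hs hμs.ne c := by
      refine Lp.ext ?_
      rw [Lp.simpleFunc.coe_indicatorConst]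
      filter_upwards [(memLp_smul_const (indicatorConstLp 2 hs hμs.ne (1 : ℂ)) c).coeFn_toLp,
        indicatorConstLp_coeFn (p := 2) (hs := hs) (hμs := hμs.ne) (c := (1 : ℂ)),
        indicatorConstLp_coeFn (p := 2) (hs := hs) (hμs := hμs.ne) (c := c)] with x h1 h2 h3
      rw [h1, h2, h3]
      by_cases hx : x ∈ s <;> simp [hx]
    rw [← h']
    exact h
  · intro f g hf hg _ h1 h2
    rw [inner_add_left, h1, h2, add_zero]
  · exact isClosed_eq (by fun_prop) (by fun_prop)

theorem exists_fieldEquiv [CompleteSpace K] :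
    ∃ U : HTensor K (Lp ℂ 2 ν) ≃ₗᵢ[ℂ] Lp K 2 ν,
      ∀ p : K × Lp ℂ 2 ν, U (tmulH p.1 p.2) = (memLp_smul_const p.2 p.1).toLp := by
  refine isTotal_tmulH'.exists_unitary isTotal_smul_const fun p q => ?_
  rw [inner_tmulH, inner_eq_integral, L2.inner_def, ← integral_const_mul]
  refine integral_congr_ae ?_
  filter_upwards [(memLp_smul_const p.2 p.1).coeFn_toLp, (memLp_smul_const q.2 q.1).coeFn_toLp]
    with s h1 h2
  rw [h1, h2, inner_smul_left, inner_smul_right]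
  ring

variable (ν K) in
/-- The unitary `K ⊗ L²(ν) ≅ L²(ν; K)`, `k ⊗ η ↦ (s ↦ η s • k)`. -/
def fieldEquiv [CompleteSpace K] : HTensor K (Lp ℂ 2 ν) ≃ₗᵢ[ℂ] Lp K 2 ν :=
  exists_fieldEquiv.choose

variable [CompleteSpace K]

theorem fieldEquiv_tmulH (k : K) (η : Lp ℂ 2 ν) :
    (fieldEquiv K ν (tmulH k η) : α → K) =ᵐ[ν] fun s => η s • k := by
  rw [fieldEquiv, exists_fieldEquiv.choose_spec (k, η)]
  exact (memLp_smul_const η k).coeFn_toLp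

theorem inner_eq_integral_fieldEquiv (v w : HTensor K (Lp ℂ 2 ν)) :
    ⟪v, w⟫_ℂ = ∫ s, ⟪fieldEquiv K ν v s, fieldEquiv K ν w s⟫_ℂ ∂ν := by
  rw [← (fieldEquiv K ν).inner_map_map, L2.inner_def]

/-- The vector `∫ F(s) ⊗ χ(ds) f`, which corresponds to `s ↦ f s • F s` in `L²(ν; K)`. -/
def vectorIntegral (f : Lp ℂ 2 ν) {F : α → K} (hF : AEStronglyMeasurable F ν) {C : ℝ}
    (hC : ∀ s, ‖F s‖ ≤ C) : HTensor K (Lp ℂ 2 ν) :=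
  (fieldEquiv K ν).symm (memLp_smul_of_bound f hF hC).toLp

theorem fieldEquiv_vectorIntegral (f : Lp ℂ 2 ν) {F : α → K} (hF : AEStronglyMeasurable F ν)
    {C : ℝ} (hC : ∀ s, ‖F s‖ ≤ C) :
    (fieldEquiv K ν (vectorIntegral f hF hC) : α → K) =ᵐ[ν] fun s => f s • F s := by
  rw [vectorIntegral, LinearIsometryEquiv.apply_symm_apply]
  exact (memLp_smul_of_bound f hF hC).coeFn_toLp

/-- A bounded field of operators acts on `K ⊗ L²(ν)` by pointwise application in `L²(ν; K)`.
Measurability is asked only after application to vectors, since `Y` need not be measurable for the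
operator norm. -/
theorem exists_fieldOperator {Y : α → K →L[ℂ] K}
    (hY : ∀ ψ : Lp K 2 ν, AEStronglyMeasurable (fun s => Y s (ψ s)) ν) {C : ℝ}
    (hC : ∀ s, ‖Y s‖ ≤ C) :
    ∃ R : HTensor K (Lp ℂ 2 ν) →L[ℂ] HTensor K (Lp ℂ 2 ν), ∀ v,
      (fieldEquiv K ν (R v) : α → K) =ᵐ[ν] fun s => Y s (fieldEquiv K ν v s) := by
  have hb : ∀ (ψ : Lp K 2 ν) s, ‖Y s (ψ s)‖ ≤ C * ‖ψ s‖ := fun ψ s =>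
    (Y s).le_of_opNorm_le (hC s) _
  have hm : ∀ ψ : Lp K 2 ν, MemLp (fun s => Y s (ψ s)) 2 ν := fun ψ =>
    (Lp.memLp ψ).of_le_mul (hY ψ) (Filter.Eventually.of_forall (hb ψ))
  let L : Lp K 2 ν →ₗ[ℂ] Lp K 2 ν :=
    { toFun := fun ψ => (hm ψ).toLp
      map_add' := fun φ ψ => by
        rw [← MemLp.toLp_add, MemLp.toLp_eq_toLp_iff]
        filter_upwards [Lp.coeFn_add φ ψ] with s hs
        rw [hs, Pi.add_apply, map_add, Pi.add_apply]
      map_smul' := fun c ψ => by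
        rw [RingHom.id_apply, ← MemLp.toLp_const_smul, MemLp.toLp_eq_toLp_iff]
        filter_upwards [Lp.coeFn_smul c ψ] with s hs
        rw [hs, Pi.smul_apply, map_smul, Pi.smul_apply] }
  have hL : ∀ ψ, ‖L ψ‖ ≤ C * ‖ψ‖ := fun ψ => by
    refine Lp.norm_le_mul_norm_of_ae_le_mul ?_
    filter_upwards [(hm ψ).coeFn_toLp] with s hs
    exact (congrArg norm hs).trans_le (hb ψ s)
  refine ⟨((fieldEquiv K ν).symm.toContinuousLinearEquiv : _ →L[ℂ] _) ∘L L.mkContinuous C hL ∘L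
    ((fieldEquiv K ν).toContinuousLinearEquiv : _ →L[ℂ] _), fun v => ?_⟩
  have h : fieldEquiv K ν ((((fieldEquiv K ν).symm.toContinuousLinearEquiv : _ →L[ℂ] _) ∘L
      L.mkContinuous C hL ∘L ((fieldEquiv K ν).toContinuousLinearEquiv : _ →L[ℂ] _)) v) =
      (hm (fieldEquiv K ν v)).toLp := by
    simp [L]
  rw [h]
  exact (hm (fieldEquiv K ν v)).coeFn_toLp

end Field

/-- A strongly continuous, bounded operator field is jointly continuous, hence preserves
measurability. -/
theorem aestronglyMeasurable_apply_of_continuous {K : Type*} [NormedAddCommGroup K]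
    [InnerProductSpace ℂ K] {ν : Measure ℝ} {Y : ℝ → K →L[ℂ] K}
    (hY : ∀ k, Continuous fun s => Y s k)
    {C : ℝ≥0} (hC : ∀ s, ‖Y s‖ ≤ C) {ψ : ℝ → K} (hψ : AEStronglyMeasurable ψ ν) :
    AEStronglyMeasurable (fun s => Y s (ψ s)) ν := by
  have hc : Continuous fun p : ℝ × K => Y p.1 p.2 :=
    continuous_prod_of_continuous_lipschitzWith' (fun p : ℝ × K => Y p.1 p.2) C
      (fun s => (Y s).lipschitz.weaken (hC s)) hY
  exact hc.comp_aestronglyMeasurable (aestronglyMeasurable_id.prodMk hψ)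

/-! ### The vectors `∫ e(S_s* f) ⊗ χ(ds) f` -/

section Wedge

open Filter Topology

theorem norm_expVec {α : Type*} [MeasurableSpace α] {μ : Measure α} [SigmaFinite μ]
    (f : Lp ℂ 2 μ) : ‖expVec f‖ = √(Real.exp (‖f‖ ^ 2)) := by
  have h := inner_expVec f f
  rw [inner_self_eq_norm_sq_to_K, inner_self_eq_norm_sq_to_K] at h
  simp only [RCLike.ofReal_eq_complex_ofReal] at h
  have h' : ‖expVec f‖ ^ 2 = Real.exp (‖f‖ ^ 2) := by exact_mod_cast h
  rw [← h', Real.sqrt_sq (norm_nonneg _)]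

theorem norm_Sadj_le (t : ℝ≥0) (f : L2R) : ‖Sadj t f‖ ≤ ‖f‖ := by
  have h : ‖Sadj t‖ ≤ 1 := by
    rw [Sadj, LinearIsometryEquiv.norm_map]
    exact (shift t).norm_toContinuousLinearMap_le
  simpa using (Sadj t).le_of_opNorm_le h f

theorem norm_expVec_Sadj_le (t : ℝ≥0) {f : L2R} {r : ℝ} (hr : ‖f‖ ≤ r) :
    ‖expVec (Sadj t f)‖ ≤ √(Real.exp (r ^ 2)) := by
  rw [norm_expVec]
  gcongr
  exact (norm_Sadj_le t f).trans hr

theorem continuous_expVec_Sadj (f : L2R) :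
    Continuous fun s : ℝ => expVec (Sadj s.toNNReal f) :=
  continuous_expVec.comp ((continuous_Sadj f).comp continuous_real_toNNReal)

/-- The vector `∫₀^∞ e(S_s* f) ⊗ χ(ds) f`. -/
def wedgeVec (f : L2R) : HTensor FockR L2R :=
  vectorIntegral f (F := fun s : ℝ => expVec (Sadj s.toNNReal f))
    (continuous_expVec_Sadj f).aestronglyMeasurable
    (fun s => norm_expVec_Sadj_le s.toNNReal le_rfl)

theorem fieldEquiv_wedgeVec (f : L2R) :
    (fieldEquiv FockR (volume.restrict (Ici (0 : ℝ))) (wedgeVec f) : ℝ → FockR)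
      =ᵐ[volume.restrict (Ici (0 : ℝ))] fun s => f s • expVec (Sadj s.toNNReal f) :=
  fieldEquiv_vectorIntegral _ _ _

theorem isVectorIntegral_wedgeVec (f : L2R) :
    IsVectorIntegral (fun s => expVec (Sadj s f)) f (wedgeVec f) := by
  intro h η
  have hae : (fun s => ⟪fieldEquiv FockR (volume.restrict (Ici (0 : ℝ))) (tmulH h η) s,
      fieldEquiv FockR (volume.restrict (Ici (0 : ℝ))) (wedgeVec f) s⟫_ℂ)
      =ᵐ[volume.restrict (Ici (0 : ℝ))]
      fun s : ℝ => ⟪h, expVec (Sadj s.toNNReal f)⟫_ℂ * (conj (η s) * f s) := by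
    filter_upwards [fieldEquiv_tmulH h η, fieldEquiv_wedgeVec f] with s h1 h2
    rw [h1, h2, inner_smul_left, inner_smul_right]
    ring
  refine ⟨(L2.integrable_inner _ _).congr hae, ?_⟩
  rw [inner_eq_integral_fieldEquiv]
  exact integral_congr_ae hae

theorem IsVectorIntegral.unique {F : ℝ≥0 → FockR} {f : L2R} {v w : HTensor FockR L2R}
    (hv : IsVectorIntegral F f v) (hw : IsVectorIntegral F f w) : v = w :=
  isTotal_tmulH'.eq_of_inner fun p => (hv p.1 p.2).2.trans (hw p.1 p.2).2.symm

theorem integrable_indicator_conj_mul (f g : L2R) :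
    Integrable ((Ici (0 : ℝ)).indicator fun x => conj (f x) * g x) :=
  (integrable_indicator_iff measurableSet_Ici).mpr (integrable_conj_mul f g)

theorem setIntegral_indicator_Ici (φ : ℝ → ℂ) {s : ℝ} (hs : 0 ≤ s) :
    ∫ x in Ici s, (Ici (0 : ℝ)).indicator φ x = ∫ x in Ici s, φ x := by
  rw [setIntegral_indicator measurableSet_Ici, inter_eq_left.mpr (Ici_subset_Ici.mpr hs)]

/-- `∫_t^∞ ⟪e(S_s* f), e(S_s* g)⟫ conj f(s) g(s) ds`, evaluated by the fundamental theorem of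
calculus because `⟪S_s* f, S_s* g⟫ = ∫_s^∞ conj f g`. -/
theorem integral_exp_inner_Sadj (t : ℝ≥0) (f g : L2R) :
    ∫ s in Ici (t : ℝ), Complex.exp ⟪Sadj s.toNNReal f, Sadj s.toNNReal g⟫_ℂ * (conj (f s) * g s) =
      Complex.exp ⟪Sadj t f, Sadj t g⟫_ℂ - 1 := by
  have h := integral_exp_mul (integrable_indicator_conj_mul f g) (t : ℝ)
  rw [setIntegral_indicator_Ici _ (NNReal.coe_nonneg t), ← inner_Sadj_Sadj] at h
  rw [← h]
  refine setIntegral_congr_fun measurableSet_Ici fun s hs => ?_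
  have hs0 : (0 : ℝ) ≤ s := t.2.trans hs
  rw [setIntegral_indicator_Ici _ hs0, indicator_of_mem (show s ∈ Ici (0 : ℝ) from hs0),
    inner_Sadj_Sadj, Real.coe_toNNReal s hs0]

theorem integrableOn_exp_inner_Sadj (f g : L2R) :
    IntegrableOn (fun s : ℝ => Complex.exp ⟪Sadj s.toNNReal f, Sadj s.toNNReal g⟫_ℂ *
      (conj (f s) * g s)) (Ici 0) := by
  refine ((integrable_exp_mul (integrable_indicator_conj_mul f g)
    (integrable_indicator_conj_mul f g)).integrableOn (s := Ici 0)).congr_fun (fun s hs => ?_)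
    measurableSet_Ici
  simp only
  rw [setIntegral_indicator_Ici _ hs, indicator_of_mem hs, inner_Sadj_Sadj, Real.coe_toNNReal s hs]

theorem inner_wedgeVec (f g : L2R) :
    ⟪wedgeVec f, wedgeVec g⟫_ℂ = Complex.exp ⟪f, g⟫_ℂ - 1 := by
  have h := integral_exp_inner_Sadj 0 f g
  rw [Sadj_zero, Sadj_zero] at h
  rw [← h, inner_eq_integral_fieldEquiv]
  refine integral_congr_ae ?_
  filter_upwards [fieldEquiv_wedgeVec f, fieldEquiv_wedgeVec g] with s h1 h2
  rw [h1, h2, inner_smul_left, inner_smul_right, inner_expVec]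
  ring

/-! ### Totality of the vectors `1 ⊕ ∫ e(S_s* f) ⊗ χ(ds) f` -/

theorem Sadj_indicator_eq_zero {A : Set ℝ} {t s : ℝ≥0} (hs : t ≤ s) (hA : A ⊆ Ico 0 (t : ℝ))
    (hm : MeasurableSet A) (hμ : volume.restrict (Ici (0 : ℝ)) A ≠ ∞) :
    Sadj s (indicatorConstLp 2 hm hμ (1 : ℂ)) = 0 := by
  refine Lp.ext ?_
  filter_upwards [Sadj_coeFn s (indicatorConstLp 2 hm hμ (1 : ℂ)),
    ae_Ici_comp_add s (indicatorConstLp_coeFn (p := 2) (hs := hm) (hμs := hμ) (c := (1 : ℂ))),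
    Lp.coeFn_zero ℂ 2 (volume.restrict (Ici (0 : ℝ))), ae_restrict_mem measurableSet_Ici]
    with x h1 h2 h3 h4
  rw [h1, h2, h3, indicator_of_notMem]
  · rfl
  · intro hx
    have h5 := (hA hx).2
    have h6 : (t : ℝ) ≤ s := hs
    have h7 : (0 : ℝ) ≤ x := h4
    linarith

variable {ψ : HTensor FockR L2R}

/-- Testing orthogonality against `S_t g + ε 1_A` and letting `ε → 0` isolates the values of `ψ`
on `A`. -/
theorem setIntegral_inner_eq_zero (h : ∀ f, ⟪wedgeVec f, ψ⟫_ℂ = 0) (g : L2R) (t : ℝ≥0) {A : Set ℝ}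
    (hm : MeasurableSet A) (hA : A ⊆ Ico 0 (t : ℝ)) :
    ∫ s in A, ⟪expVec (Sadj s.toNNReal (S t g)),
      fieldEquiv FockR (volume.restrict (Ici (0 : ℝ))) ψ s⟫_ℂ = 0 := by
  set Ψ := fieldEquiv FockR (volume.restrict (Ici (0 : ℝ))) ψ with hΨ
  have hA0 : A ⊆ Ici 0 := hA.trans Ico_subset_Ici_self
  have hrA : (volume.restrict (Ici (0 : ℝ))).restrict A = volume.restrict A := by
    rw [Measure.restrict_restrict hm, inter_eq_left.mpr hA0]
  have hfin : volume A < ∞ := (measure_mono hA).trans_lt (by simp)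
  have hμ : volume.restrict (Ici (0 : ℝ)) A ≠ ∞ :=
    ((Measure.restrict_le_self A).trans_lt hfin).ne
  set a : L2R := indicatorConstLp 2 hm hμ (1 : ℂ) with ha
  have h' : ∀ f : L2R, ∫ s in Ici (0 : ℝ), conj (f s) * ⟪expVec (Sadj s.toNNReal f), Ψ s⟫_ℂ = 0 :=
    fun f => by
      rw [← h f, inner_eq_integral_fieldEquiv]
      refine integral_congr_ae ?_
      filter_upwards [fieldEquiv_wedgeVec f] with s hs
      rw [hs, inner_smul_left]
  have hi : ∀ f : L2R, IntegrableOn (fun s : ℝ => conj (f s) * ⟪expVec (Sadj s.toNNReal f), Ψ s⟫_ℂ)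
      (Ici 0) := fun f => by
    refine (L2.integrable_inner (𝕜 := ℂ) (fieldEquiv FockR (volume.restrict (Ici (0 : ℝ)))
      (wedgeVec f)) Ψ).congr ?_
    filter_upwards [fieldEquiv_wedgeVec f] with s hs
    rw [hs, inner_smul_left]
  have hε : ∀ ε : ℝ, ε ≠ 0 →
      ∫ s in A, ⟪expVec (Sadj s.toNNReal (S t g + (ε : ℂ) • a)), Ψ s⟫_ℂ = 0 := fun ε hε => by
    have h1 : ∫ s in Ici (0 : ℝ), A.indicator (fun s : ℝ =>
        (ε : ℂ) * ⟪expVec (Sadj s.toNNReal (S t g + (ε : ℂ) • a)), Ψ s⟫_ℂ) s =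
        (∫ s in Ici (0 : ℝ), conj ((S t g + (ε : ℂ) • a : L2R) s) *
          ⟪expVec (Sadj s.toNNReal (S t g + (ε : ℂ) • a)), Ψ s⟫_ℂ) -
        ∫ s in Ici (0 : ℝ), conj (S t g s) * ⟪expVec (Sadj s.toNNReal (S t g)), Ψ s⟫_ℂ := by
      rw [← integral_sub (hi _) (hi _)]
      refine integral_congr_ae ?_
      filter_upwards [Lp.coeFn_add (S t g) ((ε : ℂ) • a), Lp.coeFn_smul (ε : ℂ) a, S_coeFn t g,
        indicatorConstLp_coeFn (p := 2) (hs := hm) (hμs := hμ) (c := (1 : ℂ)),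
        ae_restrict_mem measurableSet_Ici] with s h2 h3 h4 h5 h6
      rw [h2, Pi.add_apply, h3, Pi.smul_apply, show a s = _ from h5, h4, shiftFun]
      -- Beyond `t` the perturbation `1_A` is invisible to `S_s*`, and up to `t` the function
      -- `S_t g` vanishes.
      by_cases hs : (t : ℝ) < s
      · have hsA : s ∉ A := fun hsA => hs.not_ge (hA hsA).2.le
        have h7 : Sadj s.toNNReal a = 0 :=
          Sadj_indicator_eq_zero (NNReal.le_toNNReal_of_coe_le hs.le) hA hm hμ
        have h8 : Sadj s.toNNReal (S t g + (ε : ℂ) • a) = Sadj s.toNNReal (S t g) := by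
          rw [map_add, map_smul, h7, smul_zero, add_zero]
        rw [indicator_of_notMem hsA, indicator_of_notMem hsA, h8]
        simp
      · by_cases hsA : s ∈ A <;> simp [hs, hsA]
    rw [h', h', sub_self, setIntegral_indicator hm, inter_eq_right.mpr hA0,
      integral_const_mul] at h1
    exact (mul_eq_zero.mp h1).resolve_left (by exact_mod_cast hε)
  have hΨi : IntegrableOn (fun s => ‖Ψ s‖) A := by
    have : IsFiniteMeasure (volume.restrict A) := ⟨by simpa using hfin⟩
    have h1 := (Lp.memLp Ψ).restrict A
    rw [hrA] at h1
    exact (h1.integrable (by norm_num)).norm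
  have hΨm : AEStronglyMeasurable Ψ (volume.restrict A) := by
    have h1 := (Lp.aestronglyMeasurable Ψ).restrict (s := A)
    rwa [hrA] at h1
  have hlim : Tendsto (fun n : ℕ => ∫ s in A, ⟪expVec (Sadj s.toNNReal (S t g +
      ((1 / ((n : ℝ) + 1) : ℝ) : ℂ) • a)), Ψ s⟫_ℂ) atTop
      (𝓝 (∫ s in A, ⟪expVec (Sadj s.toNNReal (S t g)), Ψ s⟫_ℂ)) := by
    have hn : ∀ n : ℕ, 1 / ((n : ℝ) + 1) ≤ 1 := fun n => by
      rw [div_le_one (by positivity)]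
      linarith [(Nat.cast_nonneg n : (0 : ℝ) ≤ n)]
    refine tendsto_integral_of_dominated_convergence
      (fun s => √(Real.exp ((‖g‖ + ‖a‖) ^ 2)) * ‖Ψ s‖) (fun n => ?_) (hΨi.const_mul _)
      (fun n => Eventually.of_forall fun s => ?_) (Eventually.of_forall fun s => ?_)
    · exact (continuous_expVec_Sadj _).aestronglyMeasurable.inner hΨm
    · refine (norm_inner_le_norm _ _).trans ?_
      refine mul_le_mul_of_nonneg_right (norm_expVec_Sadj_le _ ?_) (norm_nonneg _)
      refine (norm_add_le _ _).trans ?_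
      rw [norm_S, norm_smul, Complex.norm_real, Real.norm_of_nonneg (by positivity)]
      gcongr
      exact mul_le_of_le_one_left (norm_nonneg _) (hn n)
    · have hc : Continuous fun ε : ℝ =>
          ⟪expVec (Sadj s.toNNReal (S t g + (ε : ℂ) • a)), Ψ s⟫_ℂ := by
        have := continuous_expVec (μ := volume.restrict (Ici (0 : ℝ)))
        fun_prop
      have h0 := (hc.tendsto 0).comp tendsto_one_div_add_atTop_nhds_zero_nat
      simp only [Complex.ofReal_zero, zero_smul, add_zero] at h0
      exact h0
  exact tendsto_nhds_unique hlim (tendsto_const_nhds.congr fun n =>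
    (hε _ (by positivity)).symm)

/-- A function orthogonal to all `wedgeVec f` is pointwise orthogonal to `e(g)`: the previous lemma
gives `⟪e(S_{t-s} g), ψ(s)⟫ = 0` for almost every `s < t`, and `t` can decrease to `s` through
rationals. -/
theorem ae_inner_expVec_eq_zero (h : ∀ f, ⟪wedgeVec f, ψ⟫_ℂ = 0) (g : L2R) :
    ∀ᵐ s ∂(volume.restrict (Ici (0 : ℝ))),
      ⟪expVec g, fieldEquiv FockR (volume.restrict (Ici (0 : ℝ))) ψ s⟫_ℂ = 0 := by
  set Ψ := fieldEquiv FockR (volume.restrict (Ici (0 : ℝ))) ψ with hΨ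
  have h1 : ∀ t : ℝ≥0, ∀ᵐ s : ℝ ∂(volume.restrict (Ici (0 : ℝ))), s < t →
      ⟪expVec (Sadj s.toNNReal (S t g)), Ψ s⟫_ℂ = 0 := fun t => by
    have hr : (volume.restrict (Ici (0 : ℝ))).restrict (Ico 0 (t : ℝ)) =
        volume.restrict (Ico 0 (t : ℝ)) := by
      rw [Measure.restrict_restrict measurableSet_Ico, inter_eq_left.mpr Ico_subset_Ici_self]
    have hΨm : MemLp Ψ 2 (volume.restrict (Ico 0 (t : ℝ))) := by
      have h1 := (Lp.memLp Ψ).restrict (Ico 0 (t : ℝ))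
      rwa [hr] at h1
    have hint : IntegrableOn (fun s : ℝ => ⟪expVec (Sadj s.toNNReal (S t g)), Ψ s⟫_ℂ)
        (Ico 0 (t : ℝ)) := by
      refine ((hΨm.integrable (by norm_num)).norm.const_mul (√(Real.exp (‖S t g‖ ^ 2)))).mono'
        ((continuous_expVec_Sadj _).aestronglyMeasurable.inner hΨm.1)
        (Eventually.of_forall fun s => ?_)
      exact (norm_inner_le_norm _ _).trans
        (mul_le_mul_of_nonneg_right (norm_expVec_Sadj_le _ le_rfl) (norm_nonneg _))
    have h0 := hint.ae_eq_zero_of_forall_setIntegral_eq_zero fun B hB _ => by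
      rw [Measure.restrict_restrict hB]
      exact setIntegral_inner_eq_zero h g t (hB.inter measurableSet_Ico) inter_subset_right
    rw [EventuallyEq, ae_restrict_iff' measurableSet_Ico] at h0
    rw [ae_restrict_iff' measurableSet_Ici]
    filter_upwards [h0] with s hs h2 h3
    exact hs ⟨h2, h3⟩
  have h2 : ∀ᵐ s : ℝ ∂(volume.restrict (Ici (0 : ℝ))), ∀ q : ℚ, s < (q : ℝ).toNNReal →
      ⟪expVec (Sadj s.toNNReal (S (q : ℝ).toNNReal g)), Ψ s⟫_ℂ = 0 :=
    ae_all_iff.mpr fun q => h1 _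
  filter_upwards [h2, ae_restrict_mem measurableSet_Ici] with s hs hs0
  have hs0' : (0 : ℝ) ≤ s := hs0
  choose q hq1 hq2 using fun n : ℕ => exists_rat_btwn
    (show s < s + 1 / ((n : ℝ) + 1) by linarith [show (0 : ℝ) < 1 / ((n : ℝ) + 1) by positivity])
  have hqs : Tendsto (fun n => (q n : ℝ)) atTop (𝓝 s) := by
    refine tendsto_of_tendsto_of_tendsto_of_le_of_le tendsto_const_nhds ?_
      (fun n => (hq1 n).le) (fun n => (hq2 n).le)
    simpa using tendsto_const_nhds.add (tendsto_one_div_add_atTop_nhds_zero_nat (𝕜 := ℝ))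
  have hd : Tendsto (fun n => (q n : ℝ).toNNReal - s.toNNReal) atTop (𝓝 0) := by
    have := ((continuous_real_toNNReal.tendsto s).comp hqs).sub
      (tendsto_const_nhds (x := s.toNNReal))
    simpa using this
  have hl : Tendsto (fun n => ⟪expVec (S ((q n : ℝ).toNNReal - s.toNNReal) g), Ψ s⟫_ℂ) atTop
      (𝓝 ⟪expVec g, Ψ s⟫_ℂ) :=
    ((continuous_expVec.tendsto g).comp ((tendsto_S_zero g).comp hd)).inner tendsto_const_nhds
  refine tendsto_nhds_unique hl (tendsto_const_nhds.congr fun n => ?_)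
  rw [← Sadj_S_of_le (Real.toNNReal_le_toNNReal (hq1 n).le)]
  exact (hs (q n) (by rw [Real.coe_toNNReal _ (hs0'.trans (hq1 n).le)]; exact hq1 n)).symm

theorem eq_zero_of_inner_wedgeVec (h : ∀ f, ⟪wedgeVec f, ψ⟫_ℂ = 0) : ψ = 0 := by
  refine (isTotal_tmulH isTotal_expVec IsTotal.id).eq_of_inner fun p => ?_
  rw [inner_zero_right, inner_eq_integral_fieldEquiv]
  refine integral_eq_zero_of_ae ?_
  filter_upwards [fieldEquiv_tmulH (expVec p.1) p.2, ae_inner_expVec_eq_zero h p.1] with s h1 h2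
  rw [h1, inner_smul_left, h2, mul_zero]
  rfl

theorem isTotal_wedge :
    IsTotal fun f : L2R => (WithLp.toLp 2 (1, wedgeVec f) : HWedge) := by
  have h0 : wedgeVec 0 = 0 := by
    rw [← inner_self_eq_zero (𝕜 := ℂ), inner_wedgeVec]
    simp
  refine isTotal_of_forall_inner_eq_zero fun v hv => ?_
  have h1 : v.fst = 0 := by
    simpa [WithLp.prod_inner_apply, h0] using hv 0
  have h2 : v.snd = 0 := eq_zero_of_inner_wedgeVec fun f => by
    have := hv f
    simp only [WithLp.prod_inner_apply] at this
    simpa [h1] using this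
  exact WithLp.ofLp_injective 2 (Prod.ext h1 h2)

theorem existsUnique_wedgeMap : ∃! W : FockR ≃ₗᵢ[ℂ] HWedge, IsWedgeMap W := by
  have key : ∀ W : FockR ≃ₗᵢ[ℂ] HWedge, IsWedgeMap W ↔
      ∀ f, W (expVec f) = WithLp.toLp 2 (1, wedgeVec f) := fun W => by
    refine forall_congr' fun f => ⟨fun h => ?_, fun h => ?_⟩
    · exact WithLp.ofLp_injective 2 (Prod.ext h.1 (h.2.unique (isVectorIntegral_wedgeVec f)))
    · rw [h]
      exact ⟨rfl, isVectorIntegral_wedgeVec f⟩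
  simp only [key]
  obtain ⟨W, hW⟩ := isTotal_expVec.exists_unitary isTotal_wedge fun f g => by
    simp [WithLp.prod_inner_apply, inner_expVec, inner_wedgeVec]
  exact ⟨W, hW, fun W' hW' => isTotal_expVec.unitary_ext fun f => (hW' f).trans (hW f).symm⟩

end Wedge

/-! ### The shift operator and the factorisation -/

section Semigroups

open Filter Topology

theorem existsUnique_shiftOp (t : ℝ≥0) : ∃! T : FockR →L[ℂ] FockR, IsShiftOp t T := by
  obtain ⟨L, hL⟩ := isTotal_expVec.exists_isometry (b := fun f : L2R => expVec (S t f))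
    fun f g => by rw [inner_expVec, inner_expVec, inner_S_S]
  exact ⟨L.toContinuousLinearMap, hL, fun T hT =>
    isTotal_expVec.clm_ext fun f => (hT f).trans (hL f).symm⟩

theorem existsUnique_factorization (t : ℝ≥0) :
    ∃! V : HTensor (FockI t) FockR ≃ₗᵢ[ℂ] FockR, IsFactorization t V := by
  have ha : IsTotal fun p : L2I t × L2R => tmulH (expVec p.1) (expVec p.2) :=
    isTotal_tmulH isTotal_expVec isTotal_expVec
  have hb : IsTotal fun p : L2I t × L2R => expVec (extendZero t p.1 + S t p.2) := by
    have h : range (fun p : L2I t × L2R => expVec (extendZero t p.1 + S t p.2)) =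
        range (expVec : L2R → FockR) :=
      Subset.antisymm (by rintro _ ⟨p, rfl⟩; exact ⟨_, rfl⟩)
        (by rintro _ ⟨f, rfl⟩; exact ⟨(cutoff t f, Sadj t f), by simp only [extendZero_cutoff_add]⟩)
    rw [IsTotal, h]
    exact isTotal_expVec
  obtain ⟨V, hV⟩ := ha.exists_unitary hb fun p q => by
    rw [inner_tmulH, inner_expVec, inner_expVec, inner_expVec, inner_split, Complex.exp_add]
  exact ⟨V, fun f g => hV (f, g), fun V' hV' =>
    ha.unitary_ext fun p => (hV' p.1 p.2).trans (hV p).symm⟩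

variable {t : ℝ≥0}

theorem IsShiftOp.adjoint_expVec {T : FockR →L[ℂ] FockR} (hT : IsShiftOp t T) (f : L2R) :
    ContinuousLinearMap.adjoint T (expVec f) = expVec (Sadj t f) :=
  isTotal_expVec.eq_of_inner fun g => by
    rw [ContinuousLinearMap.adjoint_inner_right, hT, inner_expVec, inner_expVec, Sadj,
      ContinuousLinearMap.adjoint_inner_right]

theorem IsShiftOp.inner_noEvent {T : FockR →L[ℂ] FockR} (hT : IsShiftOp t T)
    (x : FockR →L[ℂ] FockR) (f g : L2R) :
    ⟪expVec f, noEvent T x (expVec g)⟫_ℂ = ⟪expVec (Sadj t f), x (expVec (Sadj t g))⟫_ℂ := by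
  simp only [noEvent, ContinuousLinearMap.comp_apply]
  rw [← ContinuousLinearMap.adjoint_inner_left, hT.adjoint_expVec, hT.adjoint_expVec]

/-- The factorisation splits `e(f)` into the parts of `f` before and after time `t`. -/
theorem IsFactorization.symm_expVec {V : HTensor (FockI t) FockR ≃ₗᵢ[ℂ] FockR}
    (hV : IsFactorization t V) (f : L2R) :
    V.symm (expVec f) = tmulH (expVec (cutoff t f)) (expVec (Sadj t f)) := by
  rw [LinearIsometryEquiv.symm_apply_eq, hV, extendZero_cutoff_add]

theorem IsFactorization.inner_forget {V : HTensor (FockI t) FockR ≃ₗᵢ[ℂ] FockR}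
    (hV : IsFactorization t V) (x : FockR →L[ℂ] FockR) (f g : L2R) :
    ⟪expVec f, forget V x (expVec g)⟫_ℂ =
      Complex.exp (⟪f, g⟫_ℂ - ⟪Sadj t f, Sadj t g⟫_ℂ) *
        ⟪expVec (Sadj t f), x (expVec (Sadj t g))⟫_ℂ := by
  rw [← V.symm.inner_map_map, forget, transport_apply, V.symm_apply_apply, hV.symm_expVec,
    hV.symm_expVec, idTensor_tmulH, inner_tmulH, inner_expVec, inner_cutoff]

theorem norm_forget_le (V : HTensor (FockI t) FockR ≃ₗᵢ[ℂ] FockR) (x : FockR →L[ℂ] FockR) :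
    ‖forget V x‖ ≤ ‖x‖ :=
  (norm_transport_le _ _).trans (norm_idTensor_le x)

theorem adjoint_forget_comp (V : HTensor (FockI t) FockR ≃ₗᵢ[ℂ] FockR) (x : FockR →L[ℂ] FockR) :
    ContinuousLinearMap.adjoint (forget V x) ∘L forget V x =
      forget V (ContinuousLinearMap.adjoint x ∘L x) := by
  rw [forget, forget, adjoint_transport, adjoint_idTensor, ← transport_comp, ← idTensor_comp]

/-! ### Strong continuity of the forgetting maps and the operator integral -/

section Continuity

variable {V : ∀ t : ℝ≥0, HTensor (FockI t) FockR ≃ₗᵢ[ℂ] FockR}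

theorem continuous_inner_forget_expVec (hV : ∀ t, IsFactorization t (V t))
    (x : FockR →L[ℂ] FockR) (f g : L2R) :
    Continuous fun r => ⟪expVec f, forget (V r) x (expVec g)⟫_ℂ := by
  simp only [fun r => (hV r).inner_forget x f g]
  have h1 := continuous_Sadj f
  have h2 := continuous_Sadj g
  have h3 := continuous_expVec.comp h1
  have h4 := continuous_expVec.comp h2
  exact (Complex.continuous_exp.comp (continuous_const.sub (h1.inner h2))).mul
    (h3.inner (x.continuous.comp h4))

/-- A bounded family of vectors that is weakly continuous against a total family is weakly
continuous. -/
theorem continuous_inner_of_isTotal {X ι E : Type*} [TopologicalSpace X] [NormedAddCommGroup E]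
    [InnerProductSpace ℂ E] {a : ι → E} (ha : IsTotal a) {v : X → E} {C : ℝ}
    (hC : ∀ r, ‖v r‖ ≤ C) (h : ∀ i, Continuous fun r => ⟪a i, v r⟫_ℂ) (k : E) :
    Continuous fun r => ⟪k, v r⟫_ℂ := by
  have hL : ∀ r, LipschitzWith C.toNNReal fun k => ⟪k, v r⟫_ℂ := fun r =>
    LipschitzWith.of_dist_le_mul fun k l => by
      rw [dist_eq_norm, ← inner_sub_left, dist_eq_norm, mul_comm]
      refine (norm_inner_le_norm _ _).trans ?_
      gcongr
      exact (hC r).trans (Real.le_coe_toNNReal C)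
  have hs : ∀ k ∈ (Submodule.span ℂ (range a) : Set E), Continuous fun r => ⟪k, v r⟫_ℂ := by
    intro k hk
    induction hk using Submodule.span_induction with
    | mem k hk => obtain ⟨i, rfl⟩ := hk; exact h i
    | zero => simpa using continuous_const
    | add k l _ _ h1 h2 => simp only [inner_add_left]; exact h1.add h2
    | smul c k _ h1 => simp only [inner_smul_left]; exact continuous_const.mul h1
  have := continuous_prod_of_dense_continuous_lipschitzWith (fun p : E × X => ⟪p.1, v p.2⟫_ℂ)
    C.toNNReal ha hs hL
  exact this.comp (Continuous.prodMk_right k)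

/-- Strong continuity on exponential vectors: weak continuity together with continuity of
`‖forget x k‖² = ⟪k, forget (x* x) k⟫`. -/
theorem continuous_forget_expVec (hV : ∀ t, IsFactorization t (V t))
    (x : FockR →L[ℂ] FockR) (g : L2R) :
    Continuous fun r => forget (V r) x (expVec g) := by
  have hw := continuous_inner_of_isTotal isTotal_expVec
    (v := fun r => forget (V r) x (expVec g)) (C := ‖x‖ * ‖expVec g‖)
    (fun r => (forget (V r) x).le_of_opNorm_le (norm_forget_le (V r) x) _)
    (fun f => continuous_inner_forget_expVec hV x f g)
  have hn : Continuous fun r => ‖forget (V r) x (expVec g)‖ ^ 2 := by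
    have h : ∀ r, ‖forget (V r) x (expVec g)‖ ^ 2 = (⟪expVec g,
        forget (V r) (ContinuousLinearMap.adjoint x ∘L x) (expVec g)⟫_ℂ).re := fun r => by
      rw [← adjoint_forget_comp, ContinuousLinearMap.comp_apply,
        ContinuousLinearMap.adjoint_inner_right, ← RCLike.re_eq_complex_re, inner_self_eq_norm_sq]
    simp only [h]
    exact Complex.continuous_re.comp (continuous_inner_forget_expVec hV _ g g)
  rw [continuous_iff_continuousAt]
  intro r₀
  rw [ContinuousAt, tendsto_iff_norm_sub_tendsto_zero]
  have h0 : Tendsto (fun r => ‖forget (V r) x (expVec g) - forget (V r₀) x (expVec g)‖ ^ 2)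
      (𝓝 r₀) (𝓝 0) := by
    have h : ∀ r, ‖forget (V r) x (expVec g) - forget (V r₀) x (expVec g)‖ ^ 2 =
        ‖forget (V r) x (expVec g)‖ ^ 2 -
          2 * (⟪forget (V r₀) x (expVec g), forget (V r) x (expVec g)⟫_ℂ).re +
          ‖forget (V r₀) x (expVec g)‖ ^ 2 := fun r => by
      rw [norm_sub_sq (𝕜 := ℂ), inner_re_symm]
      rfl
    have hc : Continuous fun r => ‖forget (V r) x (expVec g)‖ ^ 2 -
        2 * (⟪forget (V r₀) x (expVec g), forget (V r) x (expVec g)⟫_ℂ).re +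
        ‖forget (V r₀) x (expVec g)‖ ^ 2 :=
      (hn.sub (continuous_const.mul (Complex.continuous_re.comp (hw _)))).add continuous_const
    have hc' := hc.tendsto r₀
    simp only [← h] at hc'
    simpa only [sub_self, norm_zero, ne_eq, OfNat.ofNat_ne_zero, not_false_eq_true, zero_pow]
      using hc'
  simpa using h0.sqrt

theorem continuous_forget (hV : ∀ t, IsFactorization t (V t))
    (x : FockR →L[ℂ] FockR) (k : FockR) : Continuous fun r => forget (V r) x k := by
  have hs : ∀ k ∈ (Submodule.span ℂ (range (expVec : L2R → FockR)) : Set FockR),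
      Continuous fun r => forget (V r) x k := by
    intro k hk
    induction hk using Submodule.span_induction with
    | mem k hk => obtain ⟨g, rfl⟩ := hk; exact continuous_forget_expVec hV x g
    | zero => simpa using continuous_const
    | add k l _ _ h1 h2 => simp only [map_add]; exact h1.add h2
    | smul c k _ h1 => simp only [map_smul]; exact h1.const_smul c
  have := continuous_prod_of_dense_continuous_lipschitzWith
    (fun p : FockR × ℝ≥0 => forget (V p.2) x p.1) ‖x‖₊ isTotal_expVec hs
    (fun r => (forget (V r) x).lipschitz.weaken (norm_forget_le (V r) x))
  exact this.comp (Continuous.prodMk_right k)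

/-- The integral `∫₀ᵗ forget_{t-s}(x) ⊗ χ(ds)` exists; in `L²(ℝ₊; H)` it is multiplication by the
operator field `s ↦ forget_{t-s}(x)` on `[0, t)`. -/
theorem exists_operatorIntegral (hV : ∀ t, IsFactorization t (V t)) (x : FockR →L[ℂ] FockR)
    (t : ℝ≥0) : ∃ R : HTensor FockR L2R →L[ℂ] HTensor FockR L2R,
      IsOperatorIntegral t (fun s => forget (V (t - s)) x) R ∧
      ∀ f g : L2R, ⟪wedgeVec f, R (wedgeVec g)⟫_ℂ = ∫ s in Ico 0 (t : ℝ),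
        ⟪expVec (Sadj s.toNNReal f),
          forget (V (t - s.toNNReal)) x (expVec (Sadj s.toNNReal g))⟫_ℂ * (conj (f s) * g s) := by
  classical
  let Y : ℝ → FockR →L[ℂ] FockR := fun s => forget (V (t - s.toNNReal)) x
  have hY : ∀ k, Continuous fun s => Y s k := fun k =>
    (continuous_forget hV x k).comp (continuous_const.sub continuous_real_toNNReal)
  have hYn : ∀ s, ‖Y s‖ ≤ ‖x‖₊ := fun s => norm_forget_le _ x
  -- The integral runs over `[0, t)` only; beyond `t` the truncated subtraction makes `Y` constant.
  let Z : ℝ → FockR →L[ℂ] FockR := (Ico 0 (t : ℝ)).indicator Y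
  obtain ⟨R, hR⟩ := exists_fieldOperator (ν := volume.restrict (Ici (0 : ℝ))) (Y := Z) (C := ‖x‖)
    (fun ψ => by
      have h := (aestronglyMeasurable_apply_of_continuous hY hYn
        (Lp.aestronglyMeasurable ψ)).indicator (measurableSet_Ico (a := (0 : ℝ)) (b := (t : ℝ)))
      refine h.congr (Eventually.of_forall fun s => ?_)
      by_cases hs : s ∈ Ico 0 (t : ℝ) <;> simp [Z, hs])
    (fun s => by
      by_cases hs : s ∈ Ico 0 (t : ℝ)
      · simpa [Z, hs] using hYn s
      · rw [show Z s = 0 from indicator_of_notMem hs _, norm_zero]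
        exact norm_nonneg x)
  have hint : ∀ (v w : HTensor FockR L2R) (φ : ℝ → ℂ),
      (∀ᵐ s ∂(volume.restrict (Ici (0 : ℝ))),
        ⟪fieldEquiv FockR (volume.restrict (Ici (0 : ℝ))) v s,
          Y s (fieldEquiv FockR (volume.restrict (Ici (0 : ℝ))) w s)⟫_ℂ = φ s) →
      IntegrableOn φ (Ico 0 (t : ℝ)) ∧ ⟪v, R w⟫_ℂ = ∫ s in Ico 0 (t : ℝ), φ s := by
    intro v w φ hφ
    have hae : (fun s => ⟪fieldEquiv FockR (volume.restrict (Ici (0 : ℝ))) v s,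
        fieldEquiv FockR (volume.restrict (Ici (0 : ℝ))) (R w) s⟫_ℂ)
        =ᵐ[volume.restrict (Ici (0 : ℝ))] (Ico 0 (t : ℝ)).indicator φ := by
      filter_upwards [hR w, hφ] with s h1 h2
      rw [h1]
      by_cases hs : s ∈ Ico 0 (t : ℝ)
      · simp only [Z, indicator_of_mem hs, h2]
      · simp [Z, hs]
    have hr : Ico 0 (t : ℝ) ∩ Ici 0 = Ico 0 (t : ℝ) := inter_eq_left.mpr Ico_subset_Ici_self
    constructor
    · have := (L2.integrable_inner (𝕜 := ℂ) _ _).congr hae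
      rwa [integrable_indicator_iff measurableSet_Ico, IntegrableOn,
        Measure.restrict_restrict measurableSet_Ico, hr] at this
    · rw [inner_eq_integral_fieldEquiv, integral_congr_ae hae,
        setIntegral_indicator measurableSet_Ico, inter_comm, hr]
  refine ⟨R, fun h k η ζ => hint _ _ _ ?_, fun f g => (hint _ _ _ ?_).2⟩
  · filter_upwards [fieldEquiv_tmulH h η, fieldEquiv_tmulH k ζ] with s h1 h2
    rw [h1, h2, map_smul, inner_smul_left, inner_smul_right]
    ring
  · filter_upwards [fieldEquiv_wedgeVec f, fieldEquiv_wedgeVec g] with s h1 h2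
    rw [h1, h2, map_smul, inner_smul_left, inner_smul_right]
    ring

end Continuity

/-- `∫_0^t exp (∫_s^t φ) φ(s) ds = exp (∫_0^t φ) - 1` for `φ = conj f g`, as a difference of two
integrals up to infinity. -/
theorem setIntegral_Ico_exp_inner_Sadj (t : ℝ≥0) (f g : L2R) :
    ∫ s in Ico 0 (t : ℝ), Complex.exp (⟪Sadj s.toNNReal f, Sadj s.toNNReal g⟫_ℂ -
        ⟪Sadj t f, Sadj t g⟫_ℂ) * (conj (f s) * g s) =
      Complex.exp (⟪f, g⟫_ℂ - ⟪Sadj t f, Sadj t g⟫_ℂ) - 1 := by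
  have h0 := integral_exp_inner_Sadj 0 f g
  have ht := integral_exp_inner_Sadj t f g
  have hd : Disjoint (Ico 0 (t : ℝ)) (Ici (t : ℝ)) :=
    disjoint_left.mpr fun s h1 h2 => h1.2.not_ge h2
  have hs := setIntegral_union hd measurableSet_Ici
    ((integrableOn_exp_inner_Sadj f g).mono_set Ico_subset_Ici_self)
    ((integrableOn_exp_inner_Sadj f g).mono_set (Ici_subset_Ici.mpr t.2))
  rw [Ico_union_Ici_eq_Ici (NNReal.coe_nonneg t), ht] at hs
  rw [Sadj_zero, Sadj_zero, NNReal.coe_zero, hs] at h0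
  simp only [Complex.exp_sub, div_mul_eq_mul_div]
  rw [integral_div, eq_sub_of_add_eq h0, sub_sub_sub_cancel_right, sub_div,
    div_self (Complex.exp_ne_zero _)]

/-! ### The transported semigroups -/

theorem IsWedgeMap.apply_expVec {W : FockR ≃ₗᵢ[ℂ] HWedge} (hW : IsWedgeMap W) (f : L2R) :
    W (expVec f) = WithLp.toLp 2 (1, wedgeVec f) :=
  WithLp.ofLp_injective 2
    (Prod.ext (hW f).1 ((hW f).2.unique (isVectorIntegral_wedgeVec f)))

/-- The intertwining relation `(I ⊗ S_t) w(f) = w(S_t f)`, as `S_{s+t}* S_t f = S_s* f`. -/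
theorem idTensor_S_wedgeVec (t : ℝ≥0) (f : L2R) :
    idTensor FockR (S t) (wedgeVec f) = wedgeVec (S t f) := by
  refine isTotal_tmulH'.eq_of_inner fun p => ?_
  rw [← ContinuousLinearMap.adjoint_inner_left, adjoint_idTensor, idTensor_tmulH,
    (isVectorIntegral_wedgeVec f _ _).2, (isVectorIntegral_wedgeVec (S t f) _ _).2]
  calc ∫ s in Ici (0 : ℝ), ⟪p.1, expVec (Sadj s.toNNReal f)⟫_ℂ * (conj (Sadj t p.2 s) * f s)
      = ∫ s in Ici (0 : ℝ), ⟪p.1, expVec (Sadj (s + t).toNNReal (S t f))⟫_ℂ *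
          (conj (p.2 (s + t)) * f (s + t - t)) := by
        refine integral_congr_ae ?_
        filter_upwards [Sadj_coeFn t p.2, ae_restrict_mem measurableSet_Ici] with s h1 h2
        rw [h1, Real.toNNReal_add (mem_Ici.mp h2) (NNReal.coe_nonneg t), Real.toNNReal_coe,
          Sadj_add_S, add_sub_cancel_right]
    _ = ∫ s in Ici (0 : ℝ), (if (t : ℝ) < s then ⟪p.1, expVec (Sadj s.toNNReal (S t f))⟫_ℂ *
          (conj (p.2 s) * f (s - t)) else 0) := by
        rw [setIntegral_Ici_ite, setIntegral_Ici_comp_add t fun s =>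
          ⟪p.1, expVec (Sadj s.toNNReal (S t f))⟫_ℂ * (conj (p.2 s) * f (s - t))]
    _ = _ := by
        refine integral_congr_ae ?_
        filter_upwards [S_coeFn t f] with s h1
        rw [h1, shiftFun]
        split_ifs <;> simp

theorem IsWedgeMap.transport_shiftOp {W : FockR ≃ₗᵢ[ℂ] HWedge} (hW : IsWedgeMap W)
    {T : FockR →L[ℂ] FockR} (hT : IsShiftOp t T) :
    transport W T = opSum (ContinuousLinearMap.id ℂ ℂ) (idTensor FockR (S t)) := by
  refine isTotal_wedge.clm_ext fun f => ?_
  rw [← hW.apply_expVec, transport_apply, W.symm_apply_apply, hT, hW.apply_expVec,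
    hW.apply_expVec, ← idTensor_S_wedgeVec]
  rfl

theorem IsWedgeMap.transport_noEvent {W : FockR ≃ₗᵢ[ℂ] HWedge} (hW : IsWedgeMap W)
    {T : FockR →L[ℂ] FockR} (hT : IsShiftOp t T) (X : HWedge →L[ℂ] HWedge) :
    transport W (noEvent T (transport W.symm X)) =
      opSum (ContinuousLinearMap.id ℂ ℂ) (idTensor FockR (S t)) ∘L X ∘L
        opSum (ContinuousLinearMap.id ℂ ℂ) (idTensor FockR (Sadj t)) := by
  have hX : transport W (transport W.symm X) = X := by ext1 y; simp
  have h1 : ContinuousLinearMap.adjoint (ContinuousLinearMap.id ℂ ℂ) =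
      ContinuousLinearMap.id ℂ ℂ := ContinuousLinearMap.adjoint_id
  rw [noEvent, transport_comp, transport_comp, hX, ← adjoint_transport, hW.transport_shiftOp hT,
    adjoint_opSum, adjoint_idTensor, h1]
  rfl

theorem IsWedgeMap.transport_forget {W : FockR ≃ₗᵢ[ℂ] HWedge} (hW : IsWedgeMap W)
    {T : FockR →L[ℂ] FockR} (hT : IsShiftOp t T)
    {V : ∀ t : ℝ≥0, HTensor (FockI t) FockR ≃ₗᵢ[ℂ] FockR} (hV : ∀ t, IsFactorization t (V t))
    (x : FockR →L[ℂ] FockR) :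
    ∃ R : HTensor FockR L2R →L[ℂ] HTensor FockR L2R,
      IsOperatorIntegral t (fun s => forget (V (t - s)) x) R ∧
      transport W (forget (V t) x) = transport W (noEvent T x) + opSum 0 R := by
  obtain ⟨R, hR, hRw⟩ := exists_operatorIntegral hV x t
  refine ⟨R, hR, isTotal_wedge.clm_ext_inner isTotal_wedge fun g f => ?_⟩
  -- In the integrand `forget_{t-s}(x)` contributes `exp (∫_s^t conj f g)` times a factor that does
  -- not depend on `s`, since `S_{t-s}* S_s* = S_t*`.
  have h1 : ⟪wedgeVec f, R (wedgeVec g)⟫_ℂ =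
      (Complex.exp (⟪f, g⟫_ℂ - ⟪Sadj t f, Sadj t g⟫_ℂ) - 1) *
        ⟪expVec (Sadj t f), x (expVec (Sadj t g))⟫_ℂ := by
    rw [hRw, ← setIntegral_Ico_exp_inner_Sadj, ← integral_mul_const]
    refine setIntegral_congr_fun measurableSet_Ico fun s hs => ?_
    have hst : s.toNNReal ≤ t := Real.toNNReal_le_iff_le_coe.mpr hs.2.le
    rw [(hV _).inner_forget, Sadj_sub_Sadj hst, Sadj_sub_Sadj hst]
    ring
  have h2 : ⟪(WithLp.toLp 2 (1, wedgeVec f) : HWedge),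
      opSum (0 : ℂ →L[ℂ] ℂ) R (WithLp.toLp 2 (1, wedgeVec g))⟫_ℂ =
      ⟪wedgeVec f, R (wedgeVec g)⟫_ℂ := by
    simp [WithLp.prod_inner_apply, opSum]
  rw [add_apply, inner_add_right, h2, h1, ← hW.apply_expVec,
    ← hW.apply_expVec, transport_apply, transport_apply, W.symm_apply_apply, W.inner_map_map,
    W.inner_map_map, (hV t).inner_forget, hT.inner_noEvent]
  ring

end Semigroups

end

end FockShift

open FockShift
theorem proposition4 :
    (∀ t : ℝ≥0, ∃! T : FockR →L[ℂ] FockR, IsShiftOp t T) ∧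
    (∀ t : ℝ≥0, ∃! V : HTensor (FockI t) FockR ≃ₗᵢ[ℂ] FockR, IsFactorization t V) ∧
    (∃! W : FockR ≃ₗᵢ[ℂ] HWedge, IsWedgeMap W) ∧
    ∀ (T : ℝ≥0 → FockR →L[ℂ] FockR) (_ : ∀ t, IsShiftOp t (T t))
      (V : ∀ t : ℝ≥0, HTensor (FockI t) FockR ≃ₗᵢ[ℂ] FockR) (_ : ∀ t, IsFactorization t (V t))
      (W : FockR ≃ₗᵢ[ℂ] HWedge) (_ : IsWedgeMap W)
      (t : ℝ≥0) (X : HWedge →L[ℂ] HWedge),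
      transport W (noEvent (T t) (transport W.symm X)) =
        opSum (ContinuousLinearMap.id ℂ ℂ) (idTensor FockR (S t)) ∘L X ∘L
          opSum (ContinuousLinearMap.id ℂ ℂ) (idTensor FockR (Sadj t)) ∧
      ∃ R : HTensor FockR L2R →L[ℂ] HTensor FockR L2R,
        IsOperatorIntegral t (fun s => forget (V (t - s)) (transport W.symm X)) R ∧
        transport W (forget (V t) (transport W.symm X)) =
          transport W (noEvent (T t) (transport W.symm X)) + opSum 0 R :=
  ⟨existsUnique_shiftOp, existsUnique_factorization, existsUnique_wedgeMap,
    fun _ hT _ hV _ hW t X => ⟨hW.transport_noEvent (hT t) X,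
      hW.transport_forget (hT t) hV (transport _ X)⟩⟩
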